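/- Let $R$ be a commutative ring, let $\delta\in R$ be invertible, and let $0\le k\le n$ be integers. A Brauer diagram on two rows of $2n$ nodes is a partition of these $4n$ nodes into pairs; it is called symmetric if it is invariant under the reflection $\sigma$ in the vertical axis. Diagrams $d,e$ are multiplied by stacking $d$ on top of $e$ and replacing each of the $m$ closed loops by a factor $\delta$: $d\cdot e=\delta^{m}\,(d\circ e)$. Let $\mathcal B=B(C_n,R,\delta)$ be the Brauer algebra of type $C_n$, realised as the subalgebra of the Brauer algebra on $2n$ nodes spanned by the symmetric diagrams. For $0\le i\le n$ let $f_i$ be $\delta^{-i}$ times the diagram with $i$ nested arcs, each symmetric under $\sigma$, in the middle of each row and vertical strands elsewhere; put $J_i=\mathcal Bf_i\mathcal B$ for $i\le n$ and $J_i=0$ for $i>n$. A $(2n,k)$-dangle is a partition of $\{1,\dots,2n\}$ into $k$ two-element subsets (arcs) and $2n-2k$ one-element subsets (free nodes); it is symmetric if it is invariant under $\sigma$. Let $V(2n,k)$ be the free $R$-module on the symmetric $(2n,k)$-dangles and let $V'(2n,k)$ be a copy of it. Let $H_{m}\subseteq\Sigma_{2m}$ be the hyperoctahedral group of rank $m$,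 that is, the group of permutations of $\{1,\dots,2m\}$ commuting with the reversal $j\mapsto 2m+1-j$. Let $d$ be a symmetric diagram with exactly $k$ horizontal arcs in its top row (equivalently, in its bottom row). Cutting the vertical strands of $d$ gives symmetric $(2n,k)$-dangles $d_{\mathrm{top}}$ and $d_{\mathrm{bot}}$. Number the free nodes of each row from left to right, and let $\pi_d\in H_{n-k}$ be the permutation with $\pi_d(j)=i$ if the $j$-th free node of the bottom row is joined to the $i$-th free node of the top row. For a symmetric $(2n,k)$-dangle $f$ let $D_f$ be the symmetric diagram with $(D_f)_{\mathrm{top}}=(D_f)_{\mathrm{bot}}=f$ and $\pi_{D_f}=\mathrm{id}$. Define an $R$-bilinear form $\varphi:V'(2n,k)\times V(2n,k)\to RH_{n-k}$ on dangles $f,g$ by $$\varphi(f,g)=\begin{cases}\delta^{m}\,\pi_{D_f\circ D_g}&\text{if } D_f\circ D_g \text{ has exactly } k \text{ arcs in its top row, where } m \text{ is the number of closed loops in } D_f\cdot D_g,\\ 0&\text{if new arcs are formed.}\end{cases}$$ Then: 1. for every $i\ge 0$, the ideal $J_i$ consists exactly of the linear combinations of symmetric diagrams with at least $i$ horizontal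 arcs in each row; 2. $\iota(\varphi(v,w))=\varphi(w,v)$ for all $v,w\in V(2n,k)$, where $\iota$ is the linear extension of $\pi\mapsto\pi^{-1}$ to $RH_{n-k}$; 3. there is an isomorphism of (not necessarily unital) $R$-algebras $\psi$ from $J_k/J_{k+1}$ onto the inflation of $RH_{n-k}$ along $V(2n,k)$, that is, onto the $R$-module $V(2n,k)\otimes V'(2n,k)\otimes RH_{n-k}$ with the multiplication $$(a\otimes b\otimes x)(c\otimes d\otimes y)=a\otimes d\otimes x\,\varphi(b,c)\,y ,$$ and $\psi$ sends the class of each symmetric diagram $d$ with exactly $k$ arcs in each row to $d_{\mathrm{top}}\otimes d_{\mathrm{bot}}\otimes\pi_d$. -/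

import Mathlib

namespace TypeCBrauer

open Relation

/-! ### Two involutions on a finite set -/

/-- The equivalence relation generated by two maps: `u` and `v` lie in the same class when one
can be reached from the other by steps `u ↦ a u` and `u ↦ b u` and their reverses. -/
def genSetoid {W : Type*} (a b : W → W) : Setoid W :=
  EqvGen.setoid fun u v => v = a u ∨ v = b u

theorem genSetoid_comm {W : Type*} (a b : W → W) : genSetoid a b = genSetoid b a := by
  unfold genSetoid
  congr 1
  funext u v
  exact propext or_comm

theorem genSetoid_left {W : Type*} (a b : W → W) (u : W) : genSetoid a b u (a u) :=
  EqvGen.rel _ _ (Or.inl rfl)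

theorem genSetoid_right {W : Type*} (a b : W → W) (u : W) : genSetoid a b u (b u) :=
  EqvGen.rel _ _ (Or.inr rfl)

theorem genSetoid_le {W : Type*} {a b : W → W} {s : Setoid W} (ha : ∀ u, s u (a u))
    (hb : ∀ u, s u (b u)) {u v : W} (h : genSetoid a b u v) : s u v := by
  induction h with
  | rel u v h => rcases h with rfl | rfl <;> [exact ha u; exact hb u]
  | refl u => exact s.refl' u
  | symm u v _ ih => exact s.symm' ih
  | trans u v w _ _ ih1 ih2 => exact s.trans' ih1 ih2

/-- A path that starts at an end point has exactly one other end point. -/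
theorem existsUnique_other_end {W : Type*} [Finite W] (a b : W → W) (ha : ∀ u, a (a u) = u)
    (hb : ∀ u, b (b u) = u) (x : W) (hbx : b x = x) (hax : a x ≠ x) :
    ∃! y, y ≠ x ∧ (a y = y ∨ b y = y) ∧ genSetoid a b x y := by
  let A : Equiv.Perm W := ⟨a, a, ha, ha⟩
  let B : Equiv.Perm W := ⟨b, b, hb, hb⟩
  have hA : A * A = 1 := by ext u; exact ha u
  have hB : B * B = 1 := by ext u; exact hb u
  have hAi : A⁻¹ = A := inv_eq_of_mul_eq_one_left hA
  have hBi : B⁻¹ = B := inv_eq_of_mul_eq_one_left hB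
  let c : Equiv.Perm W := B * A
  have hci : c⁻¹ = A * B := by simp [c, mul_inv_rev, hAi, hBi]
  have conjA : ∀ k : ℤ, A * c ^ k = c ^ (-k) * A := by
    intro k
    have h1 : A * c * A⁻¹ = c⁻¹ := by
      rw [hci, hAi]; simp [c, mul_assoc, hA]
    have h2 : (A * c * A⁻¹) ^ k = A * c ^ k * A⁻¹ := conj_zpow
    rw [h1, inv_zpow'] at h2
    rw [h2]; simp
  have conjB : ∀ k : ℤ, B * c ^ k = c ^ (-k) * B := by
    intro k
    have h1 : B * c * B⁻¹ = c⁻¹ := by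
      rw [hci, hBi]
      show B * (B * A) * B = A * B
      rw [← mul_assoc B B A, hB, one_mul]
    have h2 : (B * c * B⁻¹) ^ k = B * c ^ k * B⁻¹ := conj_zpow
    rw [h1, inv_zpow'] at h2
    rw [h2]; simp
  have hBx : B x = x := hbx
  have hAx : A x = (c ^ (-1 : ℤ)) x := by
    rw [zpow_neg_one, hci]
    simp [Equiv.Perm.mul_apply, hBx]
  have actA : ∀ k : ℤ, a ((c ^ k) x) = (c ^ (-k - 1)) x := by
    intro k
    have := congrArg (fun p : Equiv.Perm W => p x) (conjA k)
    simp only [Equiv.Perm.mul_apply] at this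
    rw [hAx, ← Equiv.Perm.mul_apply (c ^ (-k)), ← zpow_add] at this
    exact this
  have actB : ∀ k : ℤ, b ((c ^ k) x) = (c ^ (-k)) x := by
    intro k
    have := congrArg (fun p : Equiv.Perm W => p x) (conjB k)
    simp only [Equiv.Perm.mul_apply] at this
    rw [hBx] at this
    exact this
  have stepB : ∀ u, genSetoid a b u (c u) := fun u =>
    (genSetoid a b).trans' (genSetoid_left a b u) (genSetoid_right a b (a u))
  have hrel : ∀ k : ℤ, genSetoid a b x ((c ^ k) x) := by
    intro k
    induction k with
    | zero => exact (genSetoid a b).refl' x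
    | succ i ih =>
      rw [add_comm, zpow_add, zpow_one, Equiv.Perm.mul_apply]
      exact (genSetoid a b).trans' ih (stepB _)
    | pred i ih =>
      have h := stepB ((c ^ (-(i : ℤ) - 1)) x)
      rw [← Equiv.Perm.mul_apply] at h
      nth_rw 2 [← zpow_one c] at h
      rw [← zpow_add, show (1 : ℤ) + (-(i : ℤ) - 1) = -i by ring] at h
      exact (genSetoid a b).trans' ih ((genSetoid a b).symm' h)
  have horb : ∀ y, genSetoid a b x y → ∃ k : ℤ, y = (c ^ k) x := by
    intro y hy
    let s : Setoid W :=
      { r := fun u v => (∃ k : ℤ, u = (c ^ k) x) ↔ (∃ k : ℤ, v = (c ^ k) x)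
        iseqv := ⟨fun _ => Iff.rfl, fun h => h.symm, fun h1 h2 => h1.trans h2⟩ }
    have key : s x y := by
      refine genSetoid_le (s := s) ?_ ?_ hy
      · intro u
        constructor
        · rintro ⟨k, rfl⟩; exact ⟨_, actA k⟩
        · rintro ⟨k, hk⟩
          refine ⟨-k - 1, ?_⟩
          rw [← actA, ← hk, ha]
      · intro u
        constructor
        · rintro ⟨k, rfl⟩; exact ⟨_, actB k⟩
        · rintro ⟨k, hk⟩
          refine ⟨-k, ?_⟩
          rw [← actB, ← hk, hb]
    exact key.1 ⟨0, by simp⟩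
  let m : ℕ := Function.minimalPeriod (c • ·) x
  have hm : 0 < m :=
    Function.minimalPeriod_pos_of_mem_periodicPts
      ((Finite.injective_iff_surjective.2 (MulAction.surjective c)).mem_periodicPts x)
  have hdvd : ∀ i j : ℤ, (c ^ i) x = (c ^ j) x ↔ (m : ℤ) ∣ i - j := by
    intro i j
    have := MulAction.zpow_smul_eq_iff_minimalPeriod_dvd (a := c) (b := x) (n := i - j)
    rw [← this, sub_eq_neg_add, zpow_add, mul_smul, zpow_neg, inv_smul_eq_iff]
    rfl
  have hm1 : m ≠ 1 := by
    intro h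
    apply hax
    have h0 := (hdvd (-1) 0).2 (by rw [h]; simp)
    exact hAx.trans h0
  have ht : (x : W) = (c ^ (0 : ℤ)) x := by simp
  refine ⟨(c ^ ((m / 2 : ℕ) : ℤ)) x, ⟨?_, ?_, hrel _⟩, ?_⟩
  · intro h
    rw [ht, ← Equiv.Perm.mul_apply, ← zpow_add, hdvd] at h
    have := Int.le_of_dvd (by omega) h
    omega
  · rw [actA, actB, hdvd, hdvd]
    rcases Nat.even_or_odd' m with ⟨h, hh | hh⟩
    · right; exact ⟨-1, by omega⟩
    · left; exact ⟨-1, by omega⟩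
  · rintro y ⟨hyx, hy, hr⟩
    obtain ⟨j, rfl⟩ := horb y hr
    rw [ne_eq, show ((c ^ j) x = x) = ((c ^ j) x = (c ^ (0 : ℤ)) x) by rw [← ht], hdvd] at hyx
    rw [actA, actB, hdvd, hdvd] at hy
    rw [hdvd]
    rcases Nat.even_or_odd' m with ⟨h, hh | hh⟩
    · rcases hy with ⟨t, h1⟩ | ⟨t, h1⟩
      · exfalso
        rw [hh] at h1; push_cast at h1
        have : (2 : ℤ) * (h * t) = -2 * j - 1 := by linarith
        omega
      · have h2 : j = -(h * t) := by
          rw [hh] at h1; push_cast at h1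
          have : (2 : ℤ) * (h * t) = -2 * j := by linarith
          omega
        rcases Int.even_or_odd' t with ⟨r, rfl | rfl⟩
        · exact absurd ⟨-r, by rw [h2, hh]; push_cast; ring⟩ hyx
        · refine ⟨-r - 1, ?_⟩
          rw [h2, hh, Nat.mul_div_cancel_left _ (by norm_num)]; push_cast; ring
    · rcases hy with ⟨t, h1⟩ | ⟨t, h1⟩
      · have h3 : m / 2 = h := by omega
        rw [h3]
        have h4 : (m : ℤ) ∣ 2 * (j - h) := ⟨-t - 1, by
          have : (m : ℤ) = 2 * h + 1 := by exact_mod_cast hh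
          linear_combination (-1) * h1 + this⟩
        have hc : IsCoprime (m : ℤ) 2 := ⟨1, -h, by rw [hh]; push_cast; ring⟩
        exact hc.dvd_of_dvd_mul_left h4
      · exfalso
        have hc : IsCoprime (m : ℤ) 2 := ⟨1, -h, by rw [hh]; push_cast; ring⟩
        apply hyx
        have h4 : (m : ℤ) ∣ 2 * j := ⟨-t, by linear_combination (-1) * h1⟩
        simpa using hc.dvd_of_dvd_mul_left h4


/-! ### Brauer diagrams and their composition -/

/-- A Brauer diagram on two rows of `N` nodes: a partition of the `2N` nodes into pairs, encoded
as the fixed-point-free involution sending each node to its partner.  `Sum.inl i` is the `i`-th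
node of the top row, `Sum.inr i` the `i`-th node of the bottom row. -/
@[ext]
structure BrauerDiagram (N : ℕ) where
  partner : Fin N ⊕ Fin N → Fin N ⊕ Fin N
  invol : ∀ x, partner (partner x) = x
  ne : ∀ x, partner x ≠ x

namespace BrauerDiagram

/-- The nodes of two diagrams stacked on top of each other: top, middle and bottom row. -/
abbrev StackNode (N : ℕ) : Type := Fin N ⊕ (Fin N ⊕ Fin N)

/-- The nodes of the upper diagram as nodes of the stack. -/
def upper {N : ℕ} : Fin N ⊕ Fin N → StackNode N
  | .inl i => .inl i
  | .inr i => .inr (.inl i)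

/-- The nodes of the lower diagram as nodes of the stack. -/
def lower {N : ℕ} : Fin N ⊕ Fin N → StackNode N := Sum.inr

/-- The top and bottom row of the stack. -/
def outer {N : ℕ} : Fin N ⊕ Fin N → StackNode N
  | .inl i => .inl i
  | .inr i => .inr (.inr i)

/-- The strands of the upper diagram (the bottom row is left alone). -/
def upperStep {N : ℕ} (d : BrauerDiagram N) : StackNode N → StackNode N
  | .inl i => upper (d.partner (.inl i))
  | .inr (.inl i) => upper (d.partner (.inr i))
  | .inr (.inr i) => .inr (.inr i)

/-- The strands of the lower diagram (the top row is left alone). -/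
def lowerStep {N : ℕ} (e : BrauerDiagram N) : StackNode N → StackNode N
  | .inl i => .inl i
  | .inr x => lower (e.partner x)

/-- Two nodes are related when they lie in the same connected component of the graph obtained by
stacking `d` on top of `e`. -/
def stack {N : ℕ} (d e : BrauerDiagram N) : Setoid (StackNode N) :=
  genSetoid d.upperStep e.lowerStep

theorem upperStep_upper {N : ℕ} (d : BrauerDiagram N) (x : Fin N ⊕ Fin N) :
    d.upperStep (upper x) = upper (d.partner x) := by
  rcases x with i | i <;> rfl

theorem upperStep_invol {N : ℕ} (d : BrauerDiagram N) (u : StackNode N) :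
    d.upperStep (d.upperStep u) = u := by
  rcases u with i | i | i
  · show d.upperStep (upper (d.partner (.inl i))) = _
    rw [upperStep_upper, d.invol]; rfl
  · show d.upperStep (upper (d.partner (.inr i))) = _
    rw [upperStep_upper, d.invol]; rfl
  · rfl

theorem lowerStep_invol {N : ℕ} (d : BrauerDiagram N) (u : StackNode N) :
    d.lowerStep (d.lowerStep u) = u := by
  rcases u with i | x
  · rfl
  · show Sum.inr (d.partner (d.partner x)) = _
    rw [d.invol]

theorem upper_injective {N : ℕ} : Function.Injective (upper (N := N)) := by
  rintro (i | i) (j | j) h <;> simp_all [upper]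

theorem outer_injective {N : ℕ} : Function.Injective (outer (N := N)) := by
  rintro (i | i) (j | j) h <;> simp_all [outer]

theorem upperStep_eq {N : ℕ} (d : BrauerDiagram N) (u : StackNode N) :
    d.upperStep u = u ↔ ∃ i, u = outer (.inr i) := by
  rcases u with i | i | i
  · simp only [outer, reduceCtorEq, exists_false, iff_false]
    exact fun h => d.ne (.inl i) (upper_injective h)
  · simp only [outer, Sum.inr.injEq, reduceCtorEq, exists_false, iff_false]
    exact fun h => d.ne (.inr i) (upper_injective h)
  · simp [upperStep, outer]

theorem lowerStep_eq {N : ℕ} (d : BrauerDiagram N) (u : StackNode N) :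
    d.lowerStep u = u ↔ ∃ i, u = outer (.inl i) := by
  rcases u with i | x
  · simp [lowerStep, outer]
  · simp only [outer, reduceCtorEq, exists_false, iff_false]
    exact fun h => d.ne x (Sum.inr_injective h)

/-- Each outer node of a stack is connected to exactly one other outer node. -/
theorem existsUnique_partner {N : ℕ} (d e : BrauerDiagram N) (x : Fin N ⊕ Fin N) :
    ∃! y, y ≠ x ∧ stack d e (outer x) (outer y) := by
  have main : ∃! u, u ≠ outer x ∧ (d.upperStep u = u ∨ e.lowerStep u = u) ∧
      stack d e (outer x) u := by
    rcases x with i | i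
    · refine existsUnique_other_end _ _ d.upperStep_invol e.lowerStep_invol _
        ((e.lowerStep_eq _).2 ⟨i, rfl⟩) ?_
      rw [ne_eq, upperStep_eq]
      simp [outer]
    · have h := existsUnique_other_end _ _ e.lowerStep_invol d.upperStep_invol
        (outer (Sum.inr i)) ((d.upperStep_eq _).2 ⟨i, rfl⟩)
        (by rw [ne_eq, lowerStep_eq]; simp [outer])
      rw [genSetoid_comm] at h
      obtain ⟨u, ⟨h1, h2, h3⟩, h4⟩ := h
      exact ⟨u, ⟨h1, h2.symm, h3⟩, fun v hv => h4 v ⟨hv.1, hv.2.1.symm, hv.2.2⟩⟩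
  obtain ⟨u, ⟨h1, h2, h3⟩, huniq⟩ := main
  have hu : ∃ y, u = outer y := by
    rcases h2 with h | h
    · obtain ⟨i, hi⟩ := (d.upperStep_eq u).1 h; exact ⟨_, hi⟩
    · obtain ⟨i, hi⟩ := (e.lowerStep_eq u).1 h; exact ⟨_, hi⟩
  obtain ⟨y, rfl⟩ := hu
  refine ⟨y, ⟨fun h => h1 (by rw [h]), h3⟩, ?_⟩
  rintro z ⟨hz, hs⟩
  apply outer_injective
  refine huniq _ ⟨fun h => hz (outer_injective h), ?_, hs⟩
  rcases z with i | i
  · exact Or.inr ((e.lowerStep_eq _).2 ⟨i, rfl⟩)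
  · exact Or.inl ((d.upperStep_eq _).2 ⟨i, rfl⟩)

/-- The composite of two diagrams: `d` is placed on top of `e`, the middle row is removed, and two
outer nodes are partners when they are connected in the stack. -/
noncomputable def comp {N : ℕ} (d e : BrauerDiagram N) : BrauerDiagram N where
  partner x := (existsUnique_partner d e x).choose
  invol x := by
    have hx := (existsUnique_partner d e x).choose_spec.1
    refine ((existsUnique_partner d e _).choose_spec.2 x ⟨hx.1.symm, ?_⟩).symm
    exact (stack d e).symm' hx.2
  ne x := (existsUnique_partner d e x).choose_spec.1.1

/-- The number of closed loops: connected components of the stack without an outer node. -/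
noncomputable def loops {N : ℕ} (d e : BrauerDiagram N) : ℕ :=
  Nat.card {q : Quotient (stack d e) // ∀ x, Quotient.mk (stack d e) (outer x) ≠ q}

theorem stack_comp {N : ℕ} (d e : BrauerDiagram N) (x : Fin N ⊕ Fin N) :
    stack d e (outer x) (outer ((d.comp e).partner x)) :=
  (existsUnique_partner d e x).choose_spec.1.2

theorem eq_comp_partner {N : ℕ} {d e : BrauerDiagram N} {x y : Fin N ⊕ Fin N} (hne : y ≠ x)
    (h : stack d e (outer x) (outer y)) : y = (d.comp e).partner x :=
  (existsUnique_partner d e x).choose_spec.2 y ⟨hne, h⟩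

/-! ### Associativity of stacking, through colourings of the nodes -/

/-- The matrix of a diagram acting on two-colourings: the entry at `(s, t)` is `1` when the
colouring of the top row by `s` and of the bottom row by `t` is constant on every strand. -/
noncomputable def colMatrix {N : ℕ} (d : BrauerDiagram N) :
    Matrix (Fin N → Bool) (Fin N → Bool) ℕ :=
  open Classical in fun s t => if ∀ x, Sum.elim s t (d.partner x) = Sum.elim s t x then 1 else 0

theorem colMatrix_const {N : ℕ} (d : BrauerDiagram N) :
    d.colMatrix (fun _ => false) (fun _ => false) = 1 := by
  unfold colMatrix
  rw [if_pos]
  intro x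
  rcases x with i | i <;> rcases d.partner _ with j | j <;> rfl

theorem colMatrix_injective {N : ℕ} : Function.Injective (colMatrix (N := N)) := by
  classical
  intro d e h
  ext1
  funext x
  let col : Fin N ⊕ Fin N → Bool := fun y => decide (y = x ∨ y = d.partner x)
  have hcol : Sum.elim (col ∘ Sum.inl) (col ∘ Sum.inr) = col := by
    funext y; rcases y with i | i <;> rfl
  have h1 := congrFun (congrFun h (col ∘ Sum.inl)) (col ∘ Sum.inr)
  unfold colMatrix at h1
  rw [hcol, if_pos] at h1
  · have h2 : ∀ y, col (e.partner y) = col y := by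
      by_contra hc
      rw [if_neg hc] at h1
      exact one_ne_zero h1
    have h3 := h2 x
    have h4 : e.partner x = x ∨ e.partner x = d.partner x := by
      simpa [col] using h3
    exact (h4.resolve_left (e.ne x)).symm
  · intro y
    have e1 : d.partner y = x ↔ y = d.partner x :=
      ⟨fun h => by rw [← h, d.invol], fun h => by rw [h, d.invol]⟩
    have e2 : d.partner y = d.partner x ↔ y = x :=
      ⟨fun h => by rw [← d.invol y, h, d.invol], fun h => by rw [h]⟩
    simp only [col, e1, e2, decide_eq_decide]
    exact or_comm

/-- The colouring of a stack by `s`, `m` and `t`. -/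
def stackCol {N : ℕ} (s m t : Fin N → Bool) : StackNode N → Bool := Sum.elim s (Sum.elim m t)

theorem stackCol_outer {N : ℕ} (s m t : Fin N → Bool) (x : Fin N ⊕ Fin N) :
    stackCol s m t (outer x) = Sum.elim s t x := by
  rcases x with i | i <;> rfl

theorem stackCol_iff {N : ℕ} (d e : BrauerDiagram N) (s m t : Fin N → Bool) :
    ((∀ x, Sum.elim s m (d.partner x) = Sum.elim s m x) ∧
      (∀ x, Sum.elim m t (e.partner x) = Sum.elim m t x)) ↔
    ∀ u v, stack d e u v → stackCol s m t u = stackCol s m t v := by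
  have hu : ∀ x, stackCol s m t (upper x) = Sum.elim s m x := by
    intro x; rcases x with i | i <;> rfl
  have hl : ∀ x, stackCol s m t (lower x) = Sum.elim m t x := fun x => rfl
  constructor
  · rintro ⟨h1, h2⟩ u v huv
    refine genSetoid_le (s := Setoid.ker (stackCol s m t)) ?_ ?_ huv
    · intro u
      rw [Setoid.ker_def]
      rcases u with i | i | i
      · exact ((hu (d.partner (.inl i))).trans (h1 (.inl i))).symm
      · exact ((hu (d.partner (.inr i))).trans (h1 (.inr i))).symm
      · rfl
    · intro u
      rw [Setoid.ker_def]
      rcases u with i | x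
      · rfl
      · exact (h2 x).symm
  · intro h
    constructor
    · intro x
      rw [← hu, ← hu, ← upperStep_upper]
      exact (h _ _ (genSetoid_left _ _ _)).symm
    · intro x
      exact (h (lower x) (lower (e.partner x)) (genSetoid_right _ _ _)).symm

theorem card_middle {N : ℕ} (d e : BrauerDiagram N) (s t : Fin N → Bool)
    (hst : ∀ x, Sum.elim s t ((d.comp e).partner x) = Sum.elim s t x) :
    Nat.card {m : Fin N → Bool //
      ∀ u v, stack d e u v → stackCol s m t u = stackCol s m t v} = 2 ^ loops d e := by
  classical
  have hcons : ∀ x y, stack d e (outer x) (outer y) → Sum.elim s t x = Sum.elim s t y := by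
    intro x y hxy
    by_cases hyx : y = x
    · rw [hyx]
    · rw [eq_comp_partner hyx hxy, hst]
  let Q := {q : Quotient (stack d e) // ∀ x, Quotient.mk (stack d e) (outer x) ≠ q}
  let full : (Q → Bool) → Quotient (stack d e) → Bool := fun g q =>
    if h : ∃ x, Quotient.mk (stack d e) (outer x) = q then Sum.elim s t h.choose
    else g ⟨q, fun x hx => h ⟨x, hx⟩⟩
  have full_outer : ∀ g x, full g (Quotient.mk _ (outer x)) = Sum.elim s t x := by
    intro g x
    have hx : ∃ y, Quotient.mk (stack d e) (outer y) = Quotient.mk _ (outer x) := ⟨x, rfl⟩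
    simp only [full, dif_pos hx]
    exact hcons _ _ (Quotient.exact hx.choose_spec)
  have full_loop : ∀ g (q : Q), full g q.1 = g q := by
    intro g q
    have hq : ¬ ∃ x, Quotient.mk (stack d e) (outer x) = q.1 := fun ⟨x, hx⟩ => q.2 x hx
    simp only [full, dif_neg hq]
    rfl
  have full_eq : ∀ g u, stackCol s (fun i => full g (Quotient.mk _ (.inr (.inl i)))) t u =
      full g (Quotient.mk _ u) := by
    intro g u
    rcases u with i | i | i
    · exact (full_outer g (.inl i)).symm
    · rfl
    · exact (full_outer g (.inr i)).symm
  let E : {m : Fin N → Bool //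
      ∀ u v, stack d e u v → stackCol s m t u = stackCol s m t v} ≃ (Q → Bool) :=
    { toFun := fun m q => Quotient.lift (stackCol s m.1 t) m.2 q.1
      invFun := fun g => ⟨fun i => full g (Quotient.mk _ (.inr (.inl i))), by
        intro u v huv
        rw [full_eq, full_eq, Quotient.sound huv]⟩
      left_inv := by
        rintro ⟨m, hm⟩
        apply Subtype.ext
        funext i
        let g : Q → Bool := fun q => Quotient.lift (stackCol s m t) hm q.1
        show full g (Quotient.mk _ (.inr (.inl i))) = m i
        by_cases h : ∃ x, Quotient.mk (stack d e) (outer x) = Quotient.mk _ (.inr (.inl i))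
        · obtain ⟨x, hx⟩ := h
          rw [← hx, full_outer, ← stackCol_outer s m t]
          exact hm _ _ (Quotient.exact hx)
        · exact full_loop g ⟨_, fun x hx => h ⟨x, hx⟩⟩
      right_inv := by
        intro g
        funext q
        obtain ⟨q, hq⟩ := q
        obtain ⟨u, rfl⟩ := Quotient.exists_rep q
        show stackCol s _ t u = _
        rw [full_eq]
        exact full_loop g ⟨_, hq⟩ }
  rw [Nat.card_congr E, Nat.card_fun]
  simp [loops, Q]

theorem colMatrix_mul {N : ℕ} (d e : BrauerDiagram N) :
    d.colMatrix * e.colMatrix = 2 ^ loops d e • (d.comp e).colMatrix := by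
  classical
  ext s t
  have hL : (d.colMatrix * e.colMatrix) s t = Nat.card {m : Fin N → Bool //
      ∀ u v, stack d e u v → stackCol s m t u = stackCol s m t v} := by
    rw [Matrix.mul_apply, Nat.card_eq_fintype_card, Fintype.card_subtype, Finset.card_filter]
    refine Finset.sum_congr rfl fun m _ => ?_
    simp only [colMatrix, ← stackCol_iff]
    split_ifs <;> simp_all
  rw [hL, Matrix.smul_apply]
  by_cases hst : ∀ x, Sum.elim s t ((d.comp e).partner x) = Sum.elim s t x
  · rw [card_middle d e s t hst]
    simp [colMatrix, hst]
  · have hemp : IsEmpty {m : Fin N → Bool //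
        ∀ u v, stack d e u v → stackCol s m t u = stackCol s m t v} := by
      refine ⟨fun m => hst fun x => ?_⟩
      rw [← stackCol_outer s m.1 t, ← stackCol_outer s m.1 t]
      exact (m.2 _ _ (stack_comp d e x)).symm
    rw [Nat.card_of_isEmpty]
    simp only [colMatrix, if_neg hst]
    simp

theorem eq_of_smul_colMatrix {N a b : ℕ} {d e : BrauerDiagram N}
    (h : 2 ^ a • d.colMatrix = 2 ^ b • e.colMatrix) : a = b ∧ d = e := by
  have h0 := congrFun (congrFun h fun _ => false) fun _ => false
  rw [Matrix.smul_apply, Matrix.smul_apply, colMatrix_const, colMatrix_const] at h0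
  have hab : a = b := Nat.pow_right_injective le_rfl (by simpa using h0)
  subst hab
  refine ⟨rfl, colMatrix_injective ?_⟩
  ext s t
  have h1 := congrFun (congrFun h s) t
  simpa [Matrix.smul_apply] using h1

theorem comp_assoc_aux {N : ℕ} (d e f : BrauerDiagram N) :
    loops d e + loops (d.comp e) f = loops e f + loops d (e.comp f) ∧
      (d.comp e).comp f = d.comp (e.comp f) := by
  apply eq_of_smul_colMatrix
  have h := Matrix.mul_assoc d.colMatrix e.colMatrix f.colMatrix
  rw [colMatrix_mul, colMatrix_mul e f, Matrix.smul_mul, Matrix.mul_smul, colMatrix_mul,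
    colMatrix_mul, smul_smul, smul_smul, ← pow_add, ← pow_add] at h
  exact h

/-- The diagram with top row arcs and bottom row arcs given by the involution `s`, in which each
node fixed by `s` is joined vertically to the node below it. -/
def ofInvolution {N : ℕ} (s : Fin N → Fin N) (hs : ∀ i, s (s i) = i) : BrauerDiagram N where
  partner := Sum.elim (fun i => if s i = i then .inr i else .inl (s i))
    (fun i => if s i = i then .inl i else .inr (s i))
  invol x := by
    rcases x with i | i <;> by_cases h : s i = i
    · simp [h]
    · simp [h, hs, show ¬ i = s i from fun e => h e.symm]
    · simp [h]
    · simp [h, hs, show ¬ i = s i from fun e => h e.symm]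
  ne x := by
    rcases x with i | i <;> by_cases h : s i = i <;> simp [h]

/-- The identity diagram: all strands are vertical. -/
def idDiagram (N : ℕ) : BrauerDiagram N := ofInvolution id fun _ => rfl

theorem colMatrix_id (N : ℕ) : (idDiagram N).colMatrix = 1 := by
  ext s t
  rw [Matrix.one_apply]
  unfold colMatrix
  congr 1
  rw [eq_iff_iff]
  constructor
  · intro h; funext i; simpa [idDiagram, ofInvolution] using h (.inr i)
  · rintro rfl x
    rcases x with i | i <;> simp [idDiagram, ofInvolution]

theorem id_comp {N : ℕ} (d : BrauerDiagram N) :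
    loops (idDiagram N) d = 0 ∧ (idDiagram N).comp d = d := by
  apply eq_of_smul_colMatrix
  rw [← colMatrix_mul, colMatrix_id, one_mul, pow_zero, one_smul]

theorem comp_id {N : ℕ} (d : BrauerDiagram N) :
    loops d (idDiagram N) = 0 ∧ d.comp (idDiagram N) = d := by
  apply eq_of_smul_colMatrix
  rw [← colMatrix_mul, colMatrix_id, mul_one, pow_zero, one_smul]

/-! ### Symmetric diagrams -/

/-- Reflection of the nodes of a diagram in the vertical axis. -/
def reflect {N : ℕ} : Fin N ⊕ Fin N → Fin N ⊕ Fin N := Sum.map Fin.rev Fin.rev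

/-- A diagram is symmetric when it is invariant under reflection in the vertical axis. -/
def IsSymm {N : ℕ} (d : BrauerDiagram N) : Prop :=
  ∀ x, d.partner (reflect x) = reflect (d.partner x)

theorem IsSymm.comp {N : ℕ} {d e : BrauerDiagram N} (hd : d.IsSymm) (he : e.IsSymm) :
    (d.comp e).IsSymm := by
  let ρ : StackNode N → StackNode N := Sum.map Fin.rev (Sum.map Fin.rev Fin.rev)
  have hup : ∀ x, ρ (upper x) = upper (reflect x) := by
    intro x; rcases x with i | i <;> rfl
  have hout : ∀ x, ρ (outer x) = outer (reflect x) := by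
    intro x; rcases x with i | i <;> rfl
  have hlow : ∀ x, ρ (lower x) = lower (reflect x) := fun x => rfl
  have h1 : ∀ u, ρ (d.upperStep u) = d.upperStep (ρ u) := by
    intro u
    rcases u with i | i | i
    · exact (hup _).trans (congrArg upper (hd (.inl i)).symm)
    · exact (hup _).trans (congrArg upper (hd (.inr i)).symm)
    · rfl
  have h2 : ∀ u, ρ (e.lowerStep u) = e.lowerStep (ρ u) := by
    intro u
    rcases u with i | x
    · rfl
    · exact (hlow _).trans (congrArg lower (he x).symm)
  have hrel : ∀ u v, stack d e u v → stack d e (ρ u) (ρ v) := by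
    intro u v huv
    refine genSetoid_le (s := (stack d e).comap ρ) ?_ ?_ huv
    · intro u
      rw [Setoid.comap_rel, h1]
      exact genSetoid_left _ _ _
    · intro u
      rw [Setoid.comap_rel, h2]
      exact genSetoid_right _ _ _
  intro x
  refine (eq_comp_partner ?_ ?_).symm
  · intro h
    have : Function.Injective (reflect (N := N)) :=
      Sum.map_injective.2 ⟨Fin.rev_injective, Fin.rev_injective⟩
    exact (d.comp e).ne x (this h)
  · rw [← hout, ← hout]
    exact hrel _ _ (stack_comp d e x)

theorem ofInvolution_isSymm {N : ℕ} (s : Fin N → Fin N) (hs : ∀ i, s (s i) = i)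
    (hr : ∀ i, s i.rev = (s i).rev) : IsSymm (ofInvolution s hs) := by
  have e1 : ∀ i, (ofInvolution s hs).partner (.inl i) =
      if s i = i then .inr i else .inl (s i) := fun _ => rfl
  have e2 : ∀ i, (ofInvolution s hs).partner (.inr i) =
      if s i = i then .inl i else .inr (s i) := fun _ => rfl
  intro x
  rcases x with i | i
  · rw [show reflect (Sum.inl i) = Sum.inl i.rev from rfl, e1, e1]
    simp only [hr, Fin.rev_inj]
    split_ifs <;> rfl
  · rw [show reflect (Sum.inr i) = Sum.inr i.rev from rfl, e2, e2]
    simp only [hr, Fin.rev_inj]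
    split_ifs <;> rfl

/-! ### Cutting the vertical strands -/

/-- The top row after cutting the vertical strands: the partner of `i` when `i` lies on a
horizontal arc, and `i` itself otherwise. -/
def topRow {N : ℕ} (d : BrauerDiagram N) (i : Fin N) : Fin N :=
  Sum.elim id (fun _ => i) (d.partner (.inl i))

/-- The bottom row after cutting the vertical strands. -/
def botRow {N : ℕ} (d : BrauerDiagram N) (i : Fin N) : Fin N :=
  Sum.elim (fun _ => i) id (d.partner (.inr i))

end BrauerDiagram

/-- The number of two-element orbits of an involution. -/
def numArcs {N : ℕ} (s : Fin N → Fin N) : ℕ := (Finset.univ.filter fun i => i < s i).card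

/-- The nodes not lying on an arc. -/
def freeNodes {N : ℕ} (s : Fin N → Fin N) : Finset (Fin N) := Finset.univ.filter fun i => s i = i

theorem mem_freeNodes {N : ℕ} {s : Fin N → Fin N} {i : Fin N} : i ∈ freeNodes s ↔ s i = i := by
  simp [freeNodes]

theorem card_freeNodes {N : ℕ} (s : Fin N → Fin N) (hs : ∀ i, s (s i) = i) :
    (freeNodes s).card + 2 * numArcs s = N := by
  have h1 : (Finset.univ.filter fun i => s i < i).card = numArcs s := by
    refine Finset.card_bij (fun i _ => s i) ?_ ?_ ?_
    · intro i hi; simpa [hs] using hi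
    · intro i _ j _ h; rw [← hs i, h, hs]
    · intro i hi; exact ⟨s i, by simpa [hs] using hi, hs i⟩
  have h2 := Finset.card_filter_add_card_filter_not (s := (Finset.univ : Finset (Fin N)))
    (fun i => s i = i)
  have h3 := Finset.card_filter_add_card_filter_not
    (s := (Finset.univ : Finset (Fin N)).filter fun i => ¬ s i = i) (fun i => i < s i)
  rw [Finset.filter_filter, Finset.filter_filter] at h3
  have h4 : (Finset.univ.filter fun i => ¬ s i = i ∧ i < s i) =
      Finset.univ.filter fun i => i < s i := by
    ext i; simpa using fun h => ne_of_gt h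
  have h5 : (Finset.univ.filter fun i => ¬ s i = i ∧ ¬ i < s i) =
      Finset.univ.filter fun i => s i < i := by
    ext i
    simp only [Finset.mem_filter, Finset.mem_univ, true_and, not_lt]
    exact ⟨fun h => lt_of_le_of_ne h.2 h.1, fun h => ⟨ne_of_lt h, le_of_lt h⟩⟩
  rw [h4, h5, h1] at h3
  have h6 : (Finset.univ : Finset (Fin N)).card = N := by simp
  unfold freeNodes numArcs at *
  omega

namespace BrauerDiagram

theorem topRow_invol {N : ℕ} (d : BrauerDiagram N) (i : Fin N) : d.topRow (d.topRow i) = i := by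
  unfold topRow
  rcases h : d.partner (.inl i) with j | j
  · have h' := d.invol (.inl i)
    rw [h] at h'
    simp [h']
  · simp [h]

theorem botRow_invol {N : ℕ} (d : BrauerDiagram N) (i : Fin N) : d.botRow (d.botRow i) = i := by
  unfold botRow
  rcases h : d.partner (.inr i) with j | j
  · simp [h]
  · have h' := d.invol (.inr i)
    rw [h] at h'
    simp [h']

theorem mem_free_top {N : ℕ} (d : BrauerDiagram N) (i : Fin N) :
    i ∈ freeNodes d.topRow ↔ ∃ j, d.partner (.inl i) = .inr j := by
  rw [mem_freeNodes]
  unfold topRow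
  rcases h : d.partner (.inl i) with j | j
  · have : j ≠ i := fun e => d.ne (.inl i) (by rw [h, e])
    simp [this]
  · simp

theorem mem_free_bot {N : ℕ} (d : BrauerDiagram N) (i : Fin N) :
    i ∈ freeNodes d.botRow ↔ ∃ j, d.partner (.inr i) = .inl j := by
  rw [mem_freeNodes]
  unfold botRow
  rcases h : d.partner (.inr i) with j | j
  · simp
  · have : j ≠ i := fun e => d.ne (.inr i) (by rw [h, e])
    simp [this]

/-- The vertical strands, as a bijection from the free nodes of the bottom row to the free nodes
of the top row. -/
def through {N : ℕ} (d : BrauerDiagram N) :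
    {i // i ∈ freeNodes d.botRow} ≃ {i // i ∈ freeNodes d.topRow} where
  toFun i := ⟨Sum.elim id id (d.partner (.inr i.1)), by
    obtain ⟨j, hj⟩ := (d.mem_free_bot i.1).1 i.2
    rw [mem_free_top, hj]
    exact ⟨i.1, by rw [← d.invol (.inr i.1), hj]; rfl⟩⟩
  invFun i := ⟨Sum.elim id id (d.partner (.inl i.1)), by
    obtain ⟨j, hj⟩ := (d.mem_free_top i.1).1 i.2
    rw [mem_free_bot, hj]
    exact ⟨i.1, by rw [← d.invol (.inl i.1), hj]; rfl⟩⟩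
  left_inv i := by
    obtain ⟨j, hj⟩ := (d.mem_free_bot i.1).1 i.2
    apply Subtype.ext
    have h := d.invol (.inr i.1)
    rw [hj] at h
    simp [hj, h]
  right_inv i := by
    obtain ⟨j, hj⟩ := (d.mem_free_top i.1).1 i.2
    apply Subtype.ext
    have h := d.invol (.inl i.1)
    rw [hj] at h
    simp [hj, h]

/-- The number of horizontal arcs in the top row (which is also the number of horizontal arcs in
the bottom row). -/
def arcs {N : ℕ} (d : BrauerDiagram N) : ℕ := numArcs d.topRow

theorem arcs_eq_bot {N : ℕ} (d : BrauerDiagram N) : numArcs d.botRow = d.arcs := by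
  have h1 := card_freeNodes _ d.topRow_invol
  have h2 := card_freeNodes _ d.botRow_invol
  have h3 := Fintype.card_congr d.through
  rw [Fintype.card_coe, Fintype.card_coe] at h3
  unfold arcs
  omega

theorem card_free_top {n k : ℕ} (d : BrauerDiagram (2 * n)) (h : d.arcs = k) :
    (freeNodes d.topRow).card = 2 * (n - k) := by
  have h1 := card_freeNodes _ d.topRow_invol
  unfold arcs at h
  omega

theorem card_free_bot {n k : ℕ} (d : BrauerDiagram (2 * n)) (h : d.arcs = k) :
    (freeNodes d.botRow).card = 2 * (n - k) := by
  have h1 := card_freeNodes _ d.botRow_invol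
  rw [arcs_eq_bot] at h1
  omega

theorem IsSymm.topRow {N : ℕ} {d : BrauerDiagram N} (hd : d.IsSymm) (i : Fin N) :
    d.topRow i.rev = (d.topRow i).rev := by
  have h := hd (.inl i)
  unfold BrauerDiagram.topRow
  rw [show reflect (Sum.inl i) = Sum.inl i.rev from rfl] at h
  rw [h]
  rcases d.partner (.inl i) with j | j <;> rfl

theorem IsSymm.botRow {N : ℕ} {d : BrauerDiagram N} (hd : d.IsSymm) (i : Fin N) :
    d.botRow i.rev = (d.botRow i).rev := by
  have h := hd (.inr i)
  unfold BrauerDiagram.botRow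
  rw [show reflect (Sum.inr i) = Sum.inr i.rev from rfl] at h
  rw [h]
  rcases d.partner (.inr i) with j | j <;> rfl

end BrauerDiagram

/-! ### Dangles -/

/-- An `(N, k)`-dangle: a partition of `N` nodes into `k` two-element subsets and `N - 2 * k`
singletons, encoded as the involution whose orbits are the blocks. -/
@[ext]
structure Dangle (N k : ℕ) where
  toFun : Fin N → Fin N
  invol : ∀ i, toFun (toFun i) = i
  card_arcs : numArcs toFun = k

/-- A symmetric `(2n, k)`-dangle: a `(2n, k)`-dangle invariant under the reflection of the nodes. -/
def SymDangle (n k : ℕ) : Type :=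
  {s : Dangle (2 * n) k // ∀ i, s.toFun i.rev = (s.toFun i).rev}

/-- The hyperoctahedral group of rank `m`, as the subgroup of the symmetric group on `2m` letters
fixed by the automorphism induced by the reflection of the letters. -/
def hyperoctahedral (m : ℕ) : Subgroup (Equiv.Perm (Fin (2 * m))) :=
  Subgroup.centralizer {Fin.revPerm}

theorem mem_hyperoctahedral {m : ℕ} {p : Equiv.Perm (Fin (2 * m))} :
    p ∈ hyperoctahedral m ↔ ∀ i, p i.rev = (p i).rev := by
  unfold hyperoctahedral
  rw [Subgroup.mem_centralizer_singleton_iff]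
  constructor
  · intro h i; exact congrArg (fun q : Equiv.Perm (Fin (2 * m)) => q i) h
  · intro h; ext1 i; exact h i

theorem orderIsoOfFin_rev {N m : ℕ} (S : Finset (Fin N)) (h : S.card = m)
    (hS : ∀ i ∈ S, i.rev ∈ S) (i : Fin m) :
    (S.orderIsoOfFin h i.rev : Fin N) = (S.orderIsoOfFin h i : Fin N).rev := by
  have key : (fun j : Fin m => (S.orderIsoOfFin h j.rev : Fin N).rev) = S.orderEmbOfFin h := by
    refine Finset.orderEmbOfFin_unique h (fun j => hS _ (S.orderIsoOfFin h j.rev).2) ?_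
    intro a b hab
    rw [Fin.rev_lt_rev]
    have : S.orderIsoOfFin h b.rev < S.orderIsoOfFin h a.rev := by
      rw [OrderIso.lt_iff_lt, Fin.rev_lt_rev]; exact hab
    exact this
  have hi := congrFun key i
  rw [← Fin.rev_inj, Fin.rev_rev]
  exact hi

namespace BrauerDiagram

/-- The top row of a symmetric diagram with `k` arcs, as a symmetric dangle. -/
def topDangle {n k : ℕ} (d : BrauerDiagram (2 * n)) (hd : d.IsSymm) (h : d.arcs = k) :
    SymDangle n k :=
  ⟨⟨d.topRow, d.topRow_invol, h⟩, hd.topRow⟩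

/-- The bottom row of a symmetric diagram with `k` arcs, as a symmetric dangle. -/
def botDangle {n k : ℕ} (d : BrauerDiagram (2 * n)) (hd : d.IsSymm) (h : d.arcs = k) :
    SymDangle n k :=
  ⟨⟨d.botRow, d.botRow_invol, d.arcs_eq_bot.trans h⟩, hd.botRow⟩

/-- The permutation given by the vertical strands of a symmetric diagram with `k` arcs.  The free
nodes of each row are numbered from left to right, and `j` is sent to `i` when the `j`-th free node
of the bottom row is joined to the `i`-th free node of the top row. -/
def throughPerm {n k : ℕ} (d : BrauerDiagram (2 * n)) (hd : d.IsSymm) (h : d.arcs = k) :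
    hyperoctahedral (n - k) :=
  ⟨((Finset.orderIsoOfFin _ (d.card_free_bot h)).toEquiv.trans d.through).trans
      (Finset.orderIsoOfFin _ (d.card_free_top h)).toEquiv.symm, by
    rw [mem_hyperoctahedral]
    intro i
    simp only [Equiv.trans_apply]
    rw [Equiv.symm_apply_eq]
    apply Subtype.ext
    have hT : ∀ i ∈ freeNodes d.topRow, i.rev ∈ freeNodes d.topRow := by
      intro i hi
      rw [mem_freeNodes] at hi ⊢
      rw [hd.topRow, hi]
    have hB : ∀ i ∈ freeNodes d.botRow, i.rev ∈ freeNodes d.botRow := by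
      intro i hi
      rw [mem_freeNodes] at hi ⊢
      rw [hd.botRow, hi]
    refine Eq.trans ?_ (orderIsoOfFin_rev _ (d.card_free_top h) hT _).symm
    rw [show ∀ y, ((Finset.orderIsoOfFin _ (d.card_free_top h))
      ((Finset.orderIsoOfFin _ (d.card_free_top h)).toEquiv.symm y)) = y from
        fun y => (Finset.orderIsoOfFin _ (d.card_free_top h)).apply_symm_apply y]
    have hb := orderIsoOfFin_rev _ (d.card_free_bot h) hB i
    show Sum.elim id id (d.partner (.inr _)) = (Sum.elim id id (d.partner (.inr _))).rev
    refine (congrArg (fun z => Sum.elim id id (d.partner (Sum.inr z))) hb).trans ?_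
    have hs := hd (.inr (Finset.orderIsoOfFin _ (d.card_free_bot h) i).1)
    refine (congrArg (Sum.elim id id) hs).trans ?_
    show Sum.elim id id (reflect (d.partner (.inr _))) = _
    rcases d.partner (.inr (Finset.orderIsoOfFin _ (d.card_free_bot h) i).1) with j | j <;> rfl⟩

end BrauerDiagram

namespace SymDangle

/-- The diagram whose top and bottom row are both the dangle `s` and whose vertical strands join
each free node to the node below it, so that its permutation is the identity. -/
def diagram {n k : ℕ} (s : SymDangle n k) : BrauerDiagram (2 * n) :=
  BrauerDiagram.ofInvolution s.1.toFun s.1.invol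

theorem diagram_isSymm {n k : ℕ} (s : SymDangle n k) : s.diagram.IsSymm :=
  BrauerDiagram.ofInvolution_isSymm _ _ s.2

end SymDangle


/-! ### The Brauer algebra and its symmetric part -/

/-- The Brauer algebra (of type `A`) with loop parameter `δ`: the free `R`-module on the Brauer
diagrams on two rows of `N` nodes. -/
def BrauerAlgebra {R : Type*} [CommRing R] (_δ : R) (N : ℕ) : Type _ := BrauerDiagram N →₀ R

namespace BrauerAlgebra

noncomputable instance {R : Type*} [CommRing R] (δ : R) (N : ℕ) :
    AddCommGroup (BrauerAlgebra δ N) := inferInstanceAs (AddCommGroup (BrauerDiagram N →₀ R))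

noncomputable instance {R : Type*} [CommRing R] (δ : R) (N : ℕ) :
    Module R (BrauerAlgebra δ N) := inferInstanceAs (Module R (BrauerDiagram N →₀ R))

/-- A diagram as an element of the Brauer algebra. -/
noncomputable def of {R : Type*} [CommRing R] (δ : R) {N : ℕ} (d : BrauerDiagram N) :
    BrauerAlgebra δ N := Finsupp.single d 1

/-- The coefficient of a diagram in an element of the Brauer algebra. -/
def coeff {R : Type*} [CommRing R] {δ : R} {N : ℕ} (x : BrauerAlgebra δ N)
    (d : BrauerDiagram N) : R := Finsupp.toFun x d

/-- The multiplication: `d * e = δ ^ loops d e • comp d e` for diagrams `d` and `e`. -/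
noncomputable def mulHom {R : Type*} [CommRing R] (δ : R) (N : ℕ) :
    BrauerAlgebra δ N →ₗ[R] BrauerAlgebra δ N →ₗ[R] BrauerAlgebra δ N :=
  Finsupp.linearCombination R fun d =>
    (Finsupp.linearCombination R fun e => δ ^ BrauerDiagram.loops d e • of δ (d.comp e) :
      BrauerAlgebra δ N →ₗ[R] BrauerAlgebra δ N)

noncomputable instance {R : Type*} [CommRing R] (δ : R) (N : ℕ) : Mul (BrauerAlgebra δ N) :=
  ⟨fun x y => mulHom δ N x y⟩

noncomputable instance {R : Type*} [CommRing R] (δ : R) (N : ℕ) : One (BrauerAlgebra δ N) :=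
  ⟨of δ (BrauerDiagram.idDiagram N)⟩

theorem of_mul_of {R : Type*} [CommRing R] (δ : R) {N : ℕ} (d e : BrauerDiagram N) :
    of δ d * of δ e = δ ^ BrauerDiagram.loops d e • of δ (d.comp e) := by
  show mulHom δ N (Finsupp.single d 1) (Finsupp.single e 1) = _
  unfold mulHom
  erw [Finsupp.linearCombination_single, one_smul, Finsupp.linearCombination_single, one_smul]

theorem induction_of {R : Type*} [CommRing R] {δ : R} {N : ℕ} {p : BrauerAlgebra δ N → Prop}
    (x : BrauerAlgebra δ N) (h0 : p 0) (hadd : ∀ x y, p x → p y → p (x + y))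
    (hof : ∀ (r : R) d, p (r • of δ d)) : p x := by
  refine Finsupp.induction_linear (motive := p) x h0 hadd fun d r => ?_
  have h := hof r d
  have h1 : r • of δ d = Finsupp.single d r := by
    show r • (Finsupp.single d 1 : BrauerDiagram N →₀ R) = _
    simp
  rwa [h1] at h

theorem add_mul' {R : Type*} [CommRing R] {δ : R} {N : ℕ} (x y z : BrauerAlgebra δ N) :
    (x + y) * z = x * z + y * z := by
  show mulHom δ N (x + y) z = mulHom δ N x z + mulHom δ N y z
  rw [map_add]; rfl

theorem mul_add' {R : Type*} [CommRing R] {δ : R} {N : ℕ} (x y z : BrauerAlgebra δ N) :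
    x * (y + z) = x * y + x * z := map_add (mulHom δ N x) y z

theorem smul_mul' {R : Type*} [CommRing R] {δ : R} {N : ℕ} (r : R) (x y : BrauerAlgebra δ N) :
    (r • x) * y = r • (x * y) := by
  show mulHom δ N (r • x) y = r • mulHom δ N x y
  rw [map_smul]; rfl

theorem mul_smul' {R : Type*} [CommRing R] {δ : R} {N : ℕ} (r : R) (x y : BrauerAlgebra δ N) :
    x * (r • y) = r • (x * y) := map_smul (mulHom δ N x) r y

theorem zero_mul' {R : Type*} [CommRing R] {δ : R} {N : ℕ} (x : BrauerAlgebra δ N) :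
    0 * x = 0 := by
  show mulHom δ N 0 x = 0
  rw [map_zero]; rfl

theorem mul_zero' {R : Type*} [CommRing R] {δ : R} {N : ℕ} (x : BrauerAlgebra δ N) :
    x * 0 = 0 := map_zero (mulHom δ N x)

noncomputable instance {R : Type*} [CommRing R] (δ : R) (N : ℕ) : Ring (BrauerAlgebra δ N) :=
  { (inferInstance : AddCommGroup (BrauerAlgebra δ N)) with
    mul := (· * ·)
    one := 1
    left_distrib := mul_add'
    right_distrib := add_mul'
    zero_mul := zero_mul'
    mul_zero := mul_zero'
    mul_assoc := by
      intro x y z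
      induction x using induction_of with
      | h0 => simp only [zero_mul']
      | hadd x x' h h' => simp only [add_mul', h, h']
      | hof r d =>
        induction y using induction_of with
        | h0 => simp only [zero_mul', mul_zero']
        | hadd y y' h h' => simp only [mul_add', add_mul', h, h']
        | hof s e =>
          induction z using induction_of with
          | h0 => simp only [mul_zero']
          | hadd z z' h h' => simp only [mul_add', h, h']
          | hof t f =>
            obtain ⟨h1, h2⟩ := BrauerDiagram.comp_assoc_aux d e f
            simp only [smul_mul', mul_smul', of_mul_of, smul_smul, h2]
            congr 1
            have h3 : δ ^ (BrauerDiagram.loops d e + BrauerDiagram.loops (d.comp e) f) =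
                δ ^ (BrauerDiagram.loops e f + BrauerDiagram.loops d (e.comp f)) := by rw [h1]
            rw [pow_add, pow_add] at h3
            linear_combination (r * s * t) * h3
    one_mul := by
      intro x
      show of δ (BrauerDiagram.idDiagram N) * x = x
      induction x using induction_of with
      | h0 => exact mul_zero' _
      | hadd x y hx hy => rw [mul_add', hx, hy]
      | hof r d =>
        rw [mul_smul', of_mul_of, (BrauerDiagram.id_comp d).1, (BrauerDiagram.id_comp d).2,
          pow_zero, one_smul]
    mul_one := by
      intro x
      show x * of δ (BrauerDiagram.idDiagram N) = x
      induction x using induction_of with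
      | h0 => exact zero_mul' _
      | hadd x y hx hy => rw [add_mul', hx, hy]
      | hof r d =>
        rw [smul_mul', of_mul_of, (BrauerDiagram.comp_id d).1, (BrauerDiagram.comp_id d).2,
          pow_zero, one_smul] }

noncomputable instance {R : Type*} [CommRing R] (δ : R) (N : ℕ) :
    Algebra R (BrauerAlgebra δ N) := Algebra.ofModule smul_mul' mul_smul'

end BrauerAlgebra

/-- The Brauer algebra of type `C_n` with loop parameter `δ`: the subalgebra of the Brauer algebra
on `2n` nodes spanned by the diagrams that are invariant under reflection in the vertical axis. -/
noncomputable def typeC {R : Type*} [CommRing R] (δ : R) (n : ℕ) :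
    Subalgebra R (BrauerAlgebra δ (2 * n)) :=
  (Submodule.span R (Set.range fun d : {d : BrauerDiagram (2 * n) // d.IsSymm} =>
    BrauerAlgebra.of δ d.1)).toSubalgebra
    (Submodule.subset_span ⟨⟨BrauerDiagram.idDiagram _,
      BrauerDiagram.ofInvolution_isSymm _ _ fun _ => rfl⟩, rfl⟩)
    (by
      intro x y hx hy
      induction hx using Submodule.span_induction with
      | zero => rw [zero_mul]; exact Submodule.zero_mem _
      | add x x' _ _ h h' => rw [add_mul]; exact Submodule.add_mem _ h h'
      | smul r x _ h => rw [smul_mul_assoc]; exact Submodule.smul_mem _ _ h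
      | mem x hx =>
        obtain ⟨d, rfl⟩ := hx
        induction hy using Submodule.span_induction with
        | zero => rw [mul_zero]; exact Submodule.zero_mem _
        | add y y' _ _ h h' => rw [mul_add]; exact Submodule.add_mem _ h h'
        | smul r y _ h => rw [mul_smul_comm]; exact Submodule.smul_mem _ _ h
        | mem y hy =>
          obtain ⟨e, rfl⟩ := hy
          rw [BrauerAlgebra.of_mul_of]
          exact Submodule.smul_mem _ _ (Submodule.subset_span ⟨⟨_, d.2.comp e.2⟩, rfl⟩))

/-- A symmetric diagram as an element of the Brauer algebra of type `C_n`. -/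
noncomputable def symOf {R : Type*} [CommRing R] (δ : R) {n : ℕ} (d : BrauerDiagram (2 * n))
    (hd : d.IsSymm) : typeC δ n :=
  ⟨BrauerAlgebra.of δ d, Submodule.subset_span ⟨⟨d, hd⟩, rfl⟩⟩

/-! ### The ideals and the layers -/

/-- The involution pairing each of the `2k` innermost of the `2n` nodes with its mirror image. -/
def nestedArcs (n k : ℕ) (i : Fin (2 * n)) : Fin (2 * n) :=
  if n - k ≤ i.1 ∧ i.1 < n + k then i.rev else i

theorem nestedArcs_rev (n k : ℕ) (i : Fin (2 * n)) :
    nestedArcs n k i.rev = (nestedArcs n k i).rev := by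
  have h : (n - k ≤ i.rev.1 ∧ i.rev.1 < n + k) ↔ (n - k ≤ i.1 ∧ i.1 < n + k) := by
    have := i.2
    rw [Fin.val_rev]; omega
  unfold nestedArcs
  simp only [h]
  split_ifs <;> rfl

theorem nestedArcs_invol (n k : ℕ) (i : Fin (2 * n)) : nestedArcs n k (nestedArcs n k i) = i := by
  by_cases h : n - k ≤ i.1 ∧ i.1 < n + k
  · have h1 : nestedArcs n k i = i.rev := if_pos h
    rw [h1, nestedArcs_rev, h1, Fin.rev_rev]
  · have h1 : nestedArcs n k i = i := if_neg h
    rw [h1, h1]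

/-- The idempotent `f_k`: `δ ^ (-k)` times the diagram with `k` nested symmetric arcs in the middle
of each row and vertical strands elsewhere. -/
noncomputable def idem {R : Type*} [CommRing R] (δ : Rˣ) (n k : ℕ) : typeC (δ : R) n :=
  ((δ⁻¹ ^ k : Rˣ) : R) • symOf (δ : R)
    (BrauerDiagram.ofInvolution (nestedArcs n k) (nestedArcs_invol n k))
    (BrauerDiagram.ofInvolution_isSymm _ _ (nestedArcs_rev n k))

/-- The two-sided ideal `J_k` generated by `f_k`; it is zero for `k > n`, when there is no `f_k`. -/
noncomputable def layerIdeal {R : Type*} [CommRing R] (δ : Rˣ) (n k : ℕ) :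
    TwoSidedIdeal (typeC (δ : R) n) :=
  TwoSidedIdeal.span {x | k ≤ n ∧ x = idem δ n k}

/-- A two-sided ideal of an algebra, as an algebra without unit. -/
def idealAlgebra (R : Type*) {A : Type*} [CommRing R] [Ring A] [Algebra R A]
    (I : TwoSidedIdeal A) : NonUnitalSubalgebra R A where
  carrier := I
  zero_mem' := I.zero_mem
  add_mem' := I.add_mem
  mul_mem' := fun _ h => I.mul_mem_left _ _ h
  smul_mem' := fun r x h => by
    rw [Algebra.smul_def]
    exact I.mul_mem_left _ _ h

/-- The subquotient algebra `J_k / J_{k+1}` (without unit in general), as the image of `J_k` in the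
quotient algebra by `J_{k+1}`. -/
noncomputable def layer {R : Type*} [CommRing R] (δ : Rˣ) (n k : ℕ) :
    NonUnitalSubalgebra R (layerIdeal δ n (k + 1)).ringCon.Quotient :=
  (idealAlgebra R (layerIdeal δ n k)).map
    (((layerIdeal δ n (k + 1)).ringCon.mkₐ R : typeC (δ : R) n →ₐ[R] _) :
      typeC (δ : R) n →ₙₐ[R] (layerIdeal δ n (k + 1)).ringCon.Quotient)

/-- The class in `J_k / J_{k+1}` of an element of `J_k`. -/
noncomputable def layerMk {R : Type*} [CommRing R] (δ : Rˣ) (n k : ℕ) (x : typeC (δ : R) n)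
    (hx : x ∈ layerIdeal δ n k) : layer δ n k :=
  ⟨(layerIdeal δ n (k + 1)).ringCon.mkₐ R x, ⟨x, hx, rfl⟩⟩

/-! ### Inflations -/

open scoped TensorProduct

/-- The inflation `V ⊗ V' ⊗ B` of an algebra `B` along modules `V` and `V'` with respect to a
bilinear form `φ`. -/
def Inflation {R V V' B : Type*} [CommRing R] [AddCommGroup V] [Module R V] [AddCommGroup V']
    [Module R V'] [Ring B] [Algebra R B] (_φ : V' →ₗ[R] V →ₗ[R] B) : Type _ :=
  (V ⊗[R] V') ⊗[R] B

namespace Inflation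

section

variable {R V V' B : Type*} [CommRing R] [AddCommGroup V] [Module R V] [AddCommGroup V']
  [Module R V'] [Ring B] [Algebra R B] (φ : V' →ₗ[R] V →ₗ[R] B)

noncomputable instance : AddCommGroup (Inflation φ) :=
  inferInstanceAs (AddCommGroup ((V ⊗[R] V') ⊗[R] B))

noncomputable instance : Module R (Inflation φ) :=
  inferInstanceAs (Module R ((V ⊗[R] V') ⊗[R] B))

/-- The pure tensor `a ⊗ b ⊗ x`. -/
noncomputable def tmul (a : V) (b : V') (x : B) : Inflation φ := (a ⊗ₜ[R] b) ⊗ₜ[R] x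

/-- The map `c ⊗ d ⊗ y ↦ a ⊗ d ⊗ (x * φ b c * y)`. -/
noncomputable def act (a : V) (b : V') (x : B) :
    (V ⊗[R] V') ⊗[R] B →ₗ[R] (V ⊗[R] V') ⊗[R] B :=
  TensorProduct.lift (TensorProduct.lift (LinearMap.mk₂ R
    (fun c d => TensorProduct.mk R (V ⊗[R] V') B (a ⊗ₜ[R] d) ∘ₗ LinearMap.mulLeft R (x * φ b c))
    (by intros; ext; simp [mul_add, add_mul, TensorProduct.tmul_add, mul_assoc])
    (by intros; ext; simp [mul_assoc])
    (by intros; ext; simp [TensorProduct.tmul_add])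
    (by intros; ext; simp [TensorProduct.smul_tmul'])))

@[simp]
theorem act_tmul (a c : V) (b d : V') (x y : B) :
    act φ a b x ((c ⊗ₜ[R] d) ⊗ₜ[R] y) = (a ⊗ₜ[R] d) ⊗ₜ[R] (x * φ b c * y) := rfl

/-- The multiplication as a bilinear map. -/
noncomputable def mulHom :
    (V ⊗[R] V') ⊗[R] B →ₗ[R] (V ⊗[R] V') ⊗[R] B →ₗ[R] (V ⊗[R] V') ⊗[R] B :=
  TensorProduct.lift (TensorProduct.lift (LinearMap.mk₂ R
    (fun a b =>
      { toFun := act φ a b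
        map_add' := by
          intros; ext; simp [add_mul, TensorProduct.tmul_add]
        map_smul' := by
          intros; ext; simp })
    (by intros; ext; simp [TensorProduct.add_tmul])
    (by intros; ext; simp [TensorProduct.smul_tmul'])
    (by intros; ext; simp [mul_add, add_mul, TensorProduct.tmul_add])
    (by intros; ext; simp)))

noncomputable instance : Mul (Inflation φ) := ⟨fun s t => mulHom φ s t⟩

/-- The defining formula of the multiplication of an inflation. -/
theorem tmul_mul_tmul (a c : V) (b d : V') (x y : B) :
    tmul φ a b x * tmul φ c d y = tmul φ a d (x * φ b c * y) := rfl

theorem add_mul' (s t u : Inflation φ) : (s + t) * u = s * u + t * u :=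
  LinearMap.map_add₂ (mulHom φ) s t u

theorem mul_add' (s t u : Inflation φ) : s * (t + u) = s * t + s * u :=
  map_add (mulHom φ s) t u

theorem zero_mul' (s : Inflation φ) : 0 * s = 0 := LinearMap.map_zero₂ (mulHom φ) s

theorem mul_zero' (s : Inflation φ) : s * 0 = 0 := map_zero (mulHom φ s)

theorem induction_tmul {p : Inflation φ → Prop} (t : Inflation φ) (h0 : p 0)
    (hadd : ∀ s t, p s → p t → p (s + t)) (htmul : ∀ a b x, p (tmul φ a b x)) : p t := by
  refine TensorProduct.induction_on (motive := p) t h0 (fun u x => ?_) hadd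
  refine TensorProduct.induction_on (motive := fun u => p (u ⊗ₜ[R] x)) u ?_
    (fun a b => htmul a b x) ?_
  · rw [TensorProduct.zero_tmul]; exact h0
  · intro u v hu hv
    rw [TensorProduct.add_tmul]
    exact hadd _ _ hu hv

noncomputable instance : NonUnitalRing (Inflation φ) :=
  { (inferInstance : AddCommGroup (Inflation φ)) with
    mul := (· * ·)
    left_distrib := mul_add' φ
    right_distrib := add_mul' φ
    zero_mul := zero_mul' φ
    mul_zero := mul_zero' φ
    mul_assoc := by
      intro s t u
      induction s using induction_tmul with
      | h0 => simp only [zero_mul']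
      | hadd s s' h h' => simp only [add_mul', h, h']
      | htmul a b x =>
        induction t using induction_tmul with
        | h0 => simp only [zero_mul', mul_zero']
        | hadd s s' h h' => simp only [add_mul', mul_add', h, h']
        | htmul c d y =>
          induction u using induction_tmul with
          | h0 => simp only [mul_zero']
          | hadd s s' h h' => simp only [mul_add', h, h']
          | htmul e f z => simp only [tmul_mul_tmul, mul_assoc] }

noncomputable instance : IsScalarTower R (Inflation φ) (Inflation φ) :=
  ⟨fun r s t => LinearMap.map_smul₂ (mulHom φ) r s t⟩

noncomputable instance : SMulCommClass R (Inflation φ) (Inflation φ) :=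
  ⟨fun r s t => (map_smul (mulHom φ s) r t).symm⟩

end

end Inflation

/-! ### The bilinear form -/

/-- The free module on the symmetric `(2n, k)`-dangles. -/
abbrev DangleModule (R : Type*) [CommRing R] (n k : ℕ) : Type _ := SymDangle n k →₀ R

/-- The group algebra of the hyperoctahedral group of rank `m`. -/
abbrev HypAlgebra (R : Type*) [CommRing R] (m : ℕ) : Type _ := MonoidAlgebra R (hyperoctahedral m)

/-- The value of the bilinear form on two dangles: stack the diagram of `f` on that of `g`.  If the
composite still has `k` horizontal arcs, the value is `δ ^ (number of closed loops)` times the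
permutation of the composite; if new arcs are formed, it is `0`. -/
noncomputable def formValue {R : Type*} [CommRing R] (δ : Rˣ) (n k : ℕ) (f g : SymDangle n k) :
    HypAlgebra R (n - k) :=
  if h : (f.diagram.comp g.diagram).arcs = k then
    ((δ : R) ^ BrauerDiagram.loops f.diagram g.diagram) • MonoidAlgebra.of R _
      ((f.diagram.comp g.diagram).throughPerm (f.diagram_isSymm.comp g.diagram_isSymm) h)
  else 0

/-- The bilinear form on the free module on the symmetric dangles. -/
noncomputable def form {R : Type*} [CommRing R] (δ : Rˣ) (n k : ℕ) :
    DangleModule R n k →ₗ[R] DangleModule R n k →ₗ[R] HypAlgebra R (n - k) :=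
  Finsupp.linearCombination R fun f => Finsupp.linearCombination R fun g => formValue δ n k f g

/-- The linear extension of `p ↦ p⁻¹` to the group algebra. -/
noncomputable def invMap (R : Type*) [CommRing R] (m : ℕ) (x : HypAlgebra R m) : HypAlgebra R m :=
  MonoidAlgebra.mapDomain (fun p => p⁻¹) x

end TypeCBrauer

/-! A symmetric diagram with exactly k arcs per row is the same thing as a triple (a, b, p): its top
dangle, its bottom dangle and its permutation (`join`, `eq_join_throughPerm`, `join_injective`).
Matching middle rows give the basic product: (a, b, p) on top of (b, c, q) is (a, c, pq) and closes
exactly k loops (`join_comp_join`, `loops_join`).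

For different middle dangles b and b', insert D_b and D_b' between the factors. Each is absorbed by
its neighbour at the cost of k loops, so associativity of composition together with loop counts
(`comp_assoc_aux`) reduces everything to D_b ∘ D_b'. If that composite has new arcs, so has the
product; otherwise it equals (b, b', r), the product is (a, c, prq), and it closes as many loops as
D_b stacked on D_b'. This is the multiplication of the inflation (`join_comp_join_of_arcs`,
`arcs_join_comp_iff`).

Composition never destroys the top arcs of the upper diagram or the bottom arcs of the lower one, so
the diagrams with at least i arcs span an ideal, and this ideal contains f_i. Conversely, a diagram
(a, b, p) with l ≥ i arcs is, up to the unit δ^l, the product of (a, c, 1) and (c, b, p), where c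
consists of l nested arcs; the arcs of f_i lie among those of c, so f_i fixes (c, b, p) from the
left. Invertibility of δ enters here (`symOf_mem_layerIdeal`).

The form is symmetric up to inversion because turning diagrams upside down reverses products, fixes
every D_f and inverts permutations (`invMap_formValue`).

The isomorphism comes from the linear map `toInflation`, which kills all diagrams whose number of
arcs is not k. It is multiplicative on J_k and vanishes on J_{k+1}; the linear map `ofInflation` is
a right inverse of it, and a left inverse modulo J_{k+1}. -/

namespace TypeCBrauer

namespace BrauerDiagram

/-! ### Flipping a diagram upside down -/

/-- Reflection of a diagram in the horizontal axis. -/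
def flip {N : ℕ} (d : BrauerDiagram N) : BrauerDiagram N where
  partner x := (d.partner x.swap).swap
  invol x := by rw [Sum.swap_swap, d.invol, Sum.swap_swap]
  ne x h := d.ne x.swap (by rw [← Sum.swap_swap (d.partner x.swap), h])

theorem flip_partner {N : ℕ} (d : BrauerDiagram N) (x : Fin N ⊕ Fin N) :
    d.flip.partner x = (d.partner x.swap).swap := rfl

theorem flip_flip {N : ℕ} (d : BrauerDiagram N) : d.flip.flip = d := by
  ext1
  funext x
  simp [flip_partner]

/-- Flipping exchanges the colourings of the two rows. Questions about flipped products thus become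
questions about transposed matrices. -/
theorem colMatrix_flip {N : ℕ} (d : BrauerDiagram N) :
    d.flip.colMatrix = d.colMatrix.transpose := by
  have hsw : ∀ (s t : Fin N → Bool) x, Sum.elim s t (Sum.swap x) = Sum.elim t s x := by
    intro s t x; rcases x with i | i <;> rfl
  ext s t
  rw [Matrix.transpose_apply]
  unfold colMatrix
  congr 1
  rw [eq_iff_iff]
  constructor
  · intro h x
    have := h x.swap
    rwa [flip_partner, hsw, hsw, Sum.swap_swap] at this
  · intro h x
    rw [flip_partner, hsw, h, hsw]

/-- Transposition reverses matrix products, and a power of 2 times a colouring matrix determines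
both the exponent and the diagram. No paths in the stack need to be followed. -/
theorem flip_comp_aux {N : ℕ} (d e : BrauerDiagram N) :
    loops e.flip d.flip = loops d e ∧ e.flip.comp d.flip = (d.comp e).flip := by
  apply eq_of_smul_colMatrix
  rw [← colMatrix_mul, colMatrix_flip, colMatrix_flip, ← Matrix.transpose_mul, colMatrix_mul,
    Matrix.transpose_smul, colMatrix_flip]

theorem topRow_flip {N : ℕ} (d : BrauerDiagram N) : d.flip.topRow = d.botRow := by
  funext i
  unfold topRow botRow
  rw [flip_partner, Sum.swap_inl]
  rcases d.partner (.inr i) with j | j <;> rfl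

theorem botRow_flip {N : ℕ} (d : BrauerDiagram N) : d.flip.botRow = d.topRow := by
  rw [← topRow_flip, flip_flip]

theorem arcs_flip {N : ℕ} (d : BrauerDiagram N) : d.flip.arcs = d.arcs := by
  rw [← arcs_eq_bot d, ← topRow_flip]; rfl

/-! ### Rows of a diagram -/

theorem topRow_of_inl {N : ℕ} {d : BrauerDiagram N} {i j : Fin N}
    (h : d.partner (.inl i) = .inl j) : d.topRow i = j := by
  simp [topRow, h]

theorem topRow_of_inr {N : ℕ} {d : BrauerDiagram N} {i j : Fin N}
    (h : d.partner (.inl i) = .inr j) : d.topRow i = i := by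
  simp [topRow, h]

theorem botRow_of_inr {N : ℕ} {d : BrauerDiagram N} {i j : Fin N}
    (h : d.partner (.inr i) = .inr j) : d.botRow i = j := by
  simp [botRow, h]

theorem botRow_of_inl {N : ℕ} {d : BrauerDiagram N} {i j : Fin N}
    (h : d.partner (.inr i) = .inl j) : d.botRow i = i := by
  simp [botRow, h]

theorem partner_inl_of_ne {N : ℕ} {d : BrauerDiagram N} {i : Fin N} (h : d.topRow i ≠ i) :
    d.partner (.inl i) = .inl (d.topRow i) := by
  rcases hj : d.partner (.inl i) with j | j
  · rw [topRow_of_inl hj]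
  · exact absurd (topRow_of_inr hj) h

theorem partner_inr_of_ne {N : ℕ} {d : BrauerDiagram N} {i : Fin N} (h : d.botRow i ≠ i) :
    d.partner (.inr i) = .inr (d.botRow i) := by
  rcases hj : d.partner (.inr i) with j | j
  · exact absurd (botRow_of_inl hj) h
  · rw [botRow_of_inr hj]

theorem partner_symm {N : ℕ} {d : BrauerDiagram N} {x y : Fin N ⊕ Fin N} (h : d.partner x = y) :
    d.partner y = x := by rw [← h, d.invol]

/-- A diagram is determined by its rows and its vertical strands. -/
theorem ext_rows {N : ℕ} {d e : BrauerDiagram N} (ht : d.topRow = e.topRow)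
    (hb : d.botRow = e.botRow)
    (hv : ∀ i j, d.partner (.inr i) = .inl j → e.partner (.inr i) = .inl j) : d = e := by
  ext1
  funext x
  rcases x with i | i
  · rcases hj : d.partner (.inl i) with j | j
    · have h1 := topRow_of_inl hj
      have h2 : j ≠ i := fun h => d.ne (.inl i) (by rw [hj, h])
      rw [partner_inl_of_ne (d := e) (by rw [← ht, h1]; exact h2), ← ht, h1]
    · exact (partner_symm (hv _ _ (partner_symm hj))).symm
  · rcases hj : d.partner (.inr i) with j | j
    · exact (hv _ _ hj).symm
    · have h1 := botRow_of_inr hj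
      have h2 : j ≠ i := fun h => d.ne (.inr i) (by rw [hj, h])
      rw [partner_inr_of_ne (d := e) (by rw [← hb, h1]; exact h2), ← hb, h1]

theorem topRow_ofInvolution {N : ℕ} (s : Fin N → Fin N) (hs : ∀ i, s (s i) = i) :
    (ofInvolution s hs).topRow = s := by
  funext i
  by_cases h : s i = i <;> simp [topRow, ofInvolution, h]

theorem botRow_ofInvolution {N : ℕ} (s : Fin N → Fin N) (hs : ∀ i, s (s i) = i) :
    (ofInvolution s hs).botRow = s := by
  funext i
  by_cases h : s i = i <;> simp [botRow, ofInvolution, h]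

theorem ofInvolution_partner_inr {N : ℕ} {s : Fin N → Fin N} (hs : ∀ i, s (s i) = i) {i : Fin N}
    (h : s i = i) : (ofInvolution s hs).partner (.inr i) = .inl i := by
  simp [ofInvolution, h]

theorem ofInvolution_partner_inl {N : ℕ} {s : Fin N → Fin N} (hs : ∀ i, s (s i) = i) {i : Fin N}
    (h : s i = i) : (ofInvolution s hs).partner (.inl i) = .inr i := by
  simp [ofInvolution, h]

/-- Both rows are `s` and all remaining strands are vertical. This makes every D_f invariant under
flipping. -/
theorem flip_ofInvolution {N : ℕ} (s : Fin N → Fin N) (hs : ∀ i, s (s i) = i) :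
    (ofInvolution s hs).flip = ofInvolution s hs := by
  refine ext_rows ?_ ?_ ?_
  · rw [topRow_flip, botRow_ofInvolution, topRow_ofInvolution]
  · rw [botRow_flip, botRow_ofInvolution, topRow_ofInvolution]
  · intro i j h
    have h1 := botRow_of_inl h
    rw [botRow_flip, topRow_ofInvolution] at h1
    rw [flip_partner, Sum.swap_inr, ofInvolution_partner_inl hs h1] at h
    rw [ofInvolution_partner_inr hs h1]
    exact h

/-! ### The rows of a composite -/

theorem stack_upper {N : ℕ} (d e : BrauerDiagram N) {x y : Fin N ⊕ Fin N} (h : d.partner x = y) :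
    stack d e (upper x) (upper y) := by
  rw [← h, ← upperStep_upper]
  exact genSetoid_left _ _ _

theorem stack_lower {N : ℕ} (d e : BrauerDiagram N) {x y : Fin N ⊕ Fin N} (h : e.partner x = y) :
    stack d e (lower x) (lower y) := by
  rw [← h]
  exact genSetoid_right d.upperStep e.lowerStep (lower x)

/-- A strand of `d` between two top nodes never meets the middle row. Hence arcs are not lost under
composition. -/
theorem comp_partner_inl {N : ℕ} {d e : BrauerDiagram N} {i j : Fin N}
    (h : d.partner (.inl i) = .inl j) : (d.comp e).partner (.inl i) = .inl j := by
  refine (eq_comp_partner (fun h' => d.ne (.inl i) (h.trans h')) ?_).symm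
  exact stack_upper d e h

theorem comp_partner_inr {N : ℕ} {d e : BrauerDiagram N} {i j : Fin N}
    (h : e.partner (.inr i) = .inr j) : (d.comp e).partner (.inr i) = .inr j := by
  refine (eq_comp_partner (fun h' => e.ne (.inr i) (h.trans h')) ?_).symm
  exact stack_lower d e h

/-- A strand from top to bottom through a single middle node. -/
theorem comp_partner_through {N : ℕ} {d e : BrauerDiagram N} {i j l : Fin N}
    (h : e.partner (.inr i) = .inl j) (h' : d.partner (.inr j) = .inl l) :
    (d.comp e).partner (.inr i) = .inl l :=
  (eq_comp_partner Sum.inl_ne_inr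
    ((stack d e).trans' (stack_lower d e h) (stack_upper d e h'))).symm

theorem topRow_comp {N : ℕ} (d e : BrauerDiagram N) {i : Fin N} (h : d.topRow i ≠ i) :
    (d.comp e).topRow i = d.topRow i :=
  topRow_of_inl (comp_partner_inl (partner_inl_of_ne h))

/-- Arcs are counted by their left ends, and each arc of the top row of `d` persists. With its
mirror image `arcs_le_comp_right`, this is why counting arcs gives a filtration by ideals. -/
theorem arcs_le_comp_left {N : ℕ} (d e : BrauerDiagram N) : d.arcs ≤ (d.comp e).arcs := by
  unfold arcs numArcs
  refine Finset.card_le_card fun i hi => ?_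
  simp only [Finset.mem_filter, Finset.mem_univ, true_and] at hi ⊢
  rwa [topRow_comp d e hi.ne']

theorem arcs_le_comp_right {N : ℕ} (d e : BrauerDiagram N) : e.arcs ≤ (d.comp e).arcs := by
  have h := arcs_le_comp_left e.flip d.flip
  rwa [(flip_comp_aux d e).2, arcs_flip, arcs_flip] at h

/-- If composition creates no new arcs, then the top row is unchanged. -/
theorem topRow_comp_of_arcs_eq {N : ℕ} {d e : BrauerDiagram N} (h : (d.comp e).arcs = d.arcs) :
    (d.comp e).topRow = d.topRow := by
  -- Old arcs persist, so free nodes can only disappear; equal numbers of arcs then force the two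
  -- sets of free nodes to coincide.
  have hsub : freeNodes (d.comp e).topRow ⊆ freeNodes d.topRow := by
    intro i hi
    rw [mem_freeNodes] at hi ⊢
    by_contra hne
    exact hne (by rw [← topRow_comp d e hne, hi])
  have hcard : (freeNodes d.topRow).card ≤ (freeNodes (d.comp e).topRow).card := by
    have h1 := card_freeNodes _ d.topRow_invol
    have h2 := card_freeNodes _ (d.comp e).topRow_invol
    unfold arcs at h
    omega
  have heq := Finset.eq_of_subset_of_card_le hsub hcard
  funext i
  by_cases hi : d.topRow i = i
  · rw [← mem_freeNodes, ← heq, mem_freeNodes] at hi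
    rw [hi]
    rw [← mem_freeNodes, heq, mem_freeNodes] at hi
    exact hi.symm
  · exact topRow_comp d e hi

theorem botRow_comp_of_arcs_eq {N : ℕ} {d e : BrauerDiagram N} (h : (d.comp e).arcs = e.arcs) :
    (d.comp e).botRow = e.botRow := by
  rw [← topRow_flip, ← (flip_comp_aux d e).2, ← topRow_flip e]
  apply topRow_comp_of_arcs_eq
  rw [(flip_comp_aux d e).2, arcs_flip, arcs_flip, h]

/-! ### Stacking when the middle rows match -/

/-- When every arc in the bottom row of `d` is matched by an arc in the top row of `e`, the closed
loops are the arcs in the bottom row of `d`. -/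
theorem loops_of_extends {N : ℕ} {d e : BrauerDiagram N}
    (h : ∀ i, d.botRow i ≠ i → e.topRow i = d.botRow i) : loops d e = d.arcs := by
  classical
  let s := d.botRow
  have hs : ∀ i, s (s i) = i := d.botRow_invol
  have hd : ∀ i, s i ≠ i → d.partner (.inr i) = .inr (s i) := fun i hi => partner_inr_of_ne hi
  have he : ∀ i, s i ≠ i → e.partner (.inl i) = .inl (s i) := fun i hi => by
    have h1 := h i hi
    rw [partner_inl_of_ne (by rw [h1]; exact hi), h1]
  -- Both `d` and `e` join the middle nodes `i` and `s i`, so these two nodes form a whole component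
  -- of the stack. The proof takes membership in the pair as a predicate `p` and checks that both
  -- step maps preserve it.
  have hclass : ∀ i, s i ≠ i → ∀ v, stack d e (upper (.inr i)) v →
      v = upper (.inr i) ∨ v = upper (.inr (s i)) := by
    intro i hi v hv
    let p : StackNode N → Prop := fun v => v = upper (.inr i) ∨ v = upper (.inr (s i))
    have hsi : s (s i) ≠ s i := fun h' => hi (by rw [hs] at h'; exact h'.symm)
    have inv : ∀ a : StackNode N → StackNode N, (∀ u, a (a u) = u) →
        a (upper (.inr i)) = upper (.inr (s i)) → ∀ u, Setoid.ker p u (a u) := by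
      intro a ha h1 u
      rw [Setoid.ker_def]
      have h2 : a (upper (.inr (s i))) = upper (.inr i) := by rw [← h1, ha]
      apply propext
      constructor
      · rintro (rfl | rfl)
        · exact Or.inr h1
        · exact Or.inl h2
      · rintro (h' | h')
        · right; rw [← ha u, h', h1]
        · left; rw [← ha u, h', h2]
    have key : Setoid.ker p (upper (.inr i)) v := genSetoid_le
      (inv _ d.upperStep_invol (by rw [upperStep_upper, hd i hi]))
      (inv _ e.lowerStep_invol (congrArg lower (he i hi))) hv
    rw [Setoid.ker_def] at key
    exact key.mp (Or.inl rfl)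
  rw [← arcs_eq_bot]
  unfold loops numArcs
  rw [← Nat.card_eq_finsetCard]
  symm
  have hmem : ∀ i : {i // i ∈ Finset.univ.filter fun i => i < d.botRow i}, i.1 < s i.1 :=
    fun i => (Finset.mem_filter.1 i.2).2
  -- Each bottom arc of `d`, represented by its left end, is sent to the component it closes up to.
  refine Nat.card_eq_of_bijective
    (fun i => ⟨Quotient.mk (stack d e) (upper (.inr i.1)), fun x hx => ?_⟩) ⟨?_, ?_⟩
  · rcases hclass i.1 (hmem i).ne' _ ((stack d e).symm' (Quotient.exact hx)) with h' | h' <;>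
      rcases x with j | j <;> simp [outer, upper] at h'
  · intro i j hij
    have hij' := Quotient.exact (congrArg Subtype.val hij)
    rcases hclass i.1 (hmem i).ne' _ hij' with h' | h'
    · exact Subtype.ext (Sum.inr_injective (upper_injective h')).symm
    · exfalso
      have h1 : j.1 = s i.1 := Sum.inr_injective (upper_injective h')
      have h2 := hmem j
      rw [h1, hs] at h2
      exact absurd h2 (hmem i).le.not_gt
  · rintro ⟨q, hq⟩
    obtain ⟨u, rfl⟩ := Quotient.exists_rep q
    rcases u with j | j | j
    · exact absurd rfl (hq (.inl j))
    -- A middle node is a left end, a free node or a right end. A free node is joined by `d` to the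
    -- top row, so its component is not a closed loop; a right end is replaced by its left end.
    · rcases lt_trichotomy j (s j) with hj | hj | hj
      · exact ⟨⟨j, by simpa using hj⟩, rfl⟩
      · exfalso
        obtain ⟨l, hl⟩ := (d.mem_free_bot j).1 (mem_freeNodes.2 hj.symm)
        exact hq (.inl l) (Quotient.sound ((stack d e).symm' (stack_upper d e hl)))
      · refine ⟨⟨s j, by simpa [s, d.botRow_invol] using hj⟩, Subtype.ext (Quotient.sound ?_)⟩
        exact (stack d e).symm' (stack_upper d e (hd j hj.ne))
    · exact absurd rfl (hq (.inr j))

/-- Stacking the diagram of an involution on a diagram whose top row contains its arcs. -/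
theorem ofInvolution_comp {N : ℕ} {s : Fin N → Fin N} (hs : ∀ i, s (s i) = i)
    {e : BrauerDiagram N} (h : ∀ i, s i ≠ i → e.topRow i = s i) :
    (ofInvolution s hs).comp e = e := by
  have key : ∀ i y, e.partner (.inl i) = y → ((ofInvolution s hs).comp e).partner (.inl i) = y := by
    intro i y hy
    by_cases hi : s i = i
    -- A free node of `s` drops straight to the middle row and follows `e`. If `e` returns it to the
    -- middle row at `j`, then `j` is also free for `s`, since the arcs of `s` are arcs of `e`, and
    -- the path runs straight up again.
    · have hfree := ofInvolution_partner_inl hs hi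
      have h0 := (stack _ e).trans' (stack_upper _ e hfree) (stack_lower (ofInvolution s hs) e hy)
      rcases y with j | j
      · have hj : s j = j := by
          by_contra hj
          have h1 := h j hj
          rw [topRow_of_inl (partner_symm hy)] at h1
          rw [h1, hs] at hi
          exact hj hi.symm
        exact (eq_comp_partner (fun h' => e.ne (.inl i) (hy.trans h'))
          ((stack _ e).trans' h0
            (stack_upper _ e (ofInvolution_partner_inr hs hj)))).symm
      · exact (eq_comp_partner Sum.inr_ne_inl h0).symm
    · have h1 := h i hi
      rw [partner_inl_of_ne (by rw [h1]; exact hi), h1] at hy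
      rw [← hy]
      refine comp_partner_inl ?_
      rw [partner_inl_of_ne (by rw [topRow_ofInvolution]; exact hi), topRow_ofInvolution]
  ext1
  funext x
  rcases x with i | i
  · exact key i _ rfl
  · rcases hy : e.partner (.inr i) with j | j
    · exact partner_symm (key j _ (partner_symm hy))
    · exact comp_partner_inr hy

theorem arcs_ofInvolution {N : ℕ} (s : Fin N → Fin N) (hs : ∀ i, s (s i) = i) :
    (ofInvolution s hs).arcs = numArcs s := by
  unfold arcs
  rw [topRow_ofInvolution]

/-- When the middle rows agree, no new arcs are formed. -/
theorem arcs_comp_of_eq {N : ℕ} {d e : BrauerDiagram N} (h : d.botRow = e.topRow) :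
    (d.comp e).arcs = d.arcs := by
  have hle := arcs_le_comp_left d e
  -- A vertical strand of `d` ends at a free middle node, where a vertical strand of `e` takes over.
  -- So no free top node is lost, which bounds the number of arcs from above.
  have hsub : freeNodes d.topRow ⊆ freeNodes (d.comp e).topRow := by
    intro i hi
    obtain ⟨j, hj⟩ := (d.mem_free_top i).1 hi
    have hfree : j ∈ freeNodes e.topRow := by
      rw [← h, mem_free_bot]
      exact ⟨i, partner_symm hj⟩
    obtain ⟨l, hl⟩ := (e.mem_free_top j).1 hfree
    rw [mem_free_top]
    exact ⟨l, partner_symm (comp_partner_through (partner_symm hl) (partner_symm hj))⟩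
  have h1 := card_freeNodes _ d.topRow_invol
  have h2 := card_freeNodes _ (d.comp e).topRow_invol
  have h3 := Finset.card_le_card hsub
  unfold arcs at *
  omega

end BrauerDiagram

/-! ### Diagrams from a pair of dangles and a permutation -/

namespace SymDangle

theorem card_freeNodes {n k : ℕ} (a : SymDangle n k) :
    (freeNodes a.1.toFun).card = 2 * (n - k) := by
  have h1 := TypeCBrauer.card_freeNodes _ a.1.invol
  have h2 := a.1.card_arcs
  omega

@[ext]
theorem ext {n k : ℕ} {a b : SymDangle n k} (h : a.1.toFun = b.1.toFun) : a = b :=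
  Subtype.ext (Dangle.ext h)

/-- The free nodes of a dangle, numbered from left to right. -/
def node {n k : ℕ} (a : SymDangle n k) (j : Fin (2 * (n - k))) : Fin (2 * n) :=
  (freeNodes a.1.toFun).orderIsoOfFin a.card_freeNodes j

theorem toFun_node {n k : ℕ} (a : SymDangle n k) (j : Fin (2 * (n - k))) :
    a.1.toFun (a.node j) = a.node j :=
  mem_freeNodes.1 ((freeNodes a.1.toFun).orderIsoOfFin a.card_freeNodes j).2

/-- The position of a free node among the free nodes. -/
def index {n k : ℕ} (a : SymDangle n k) (i : Fin (2 * n)) (h : a.1.toFun i = i) :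
    Fin (2 * (n - k)) :=
  ((freeNodes a.1.toFun).orderIsoOfFin a.card_freeNodes).symm ⟨i, mem_freeNodes.2 h⟩

theorem node_index {n k : ℕ} (a : SymDangle n k) (i : Fin (2 * n)) (h : a.1.toFun i = i) :
    a.node (a.index i h) = i := by
  simp [node, index]

theorem index_node {n k : ℕ} (a : SymDangle n k) (j : Fin (2 * (n - k)))
    (h : a.1.toFun (a.node j) = a.node j) : a.index (a.node j) h = j :=
  ((freeNodes a.1.toFun).orderIsoOfFin a.card_freeNodes).symm_apply_apply j

theorem node_injective {n k : ℕ} (a : SymDangle n k) : Function.Injective a.node := by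
  intro i j h
  rw [← a.index_node i (a.toFun_node i), ← a.index_node j (a.toFun_node j)]
  simp only [h]

theorem exists_node {n k : ℕ} (a : SymDangle n k) {i : Fin (2 * n)} (h : a.1.toFun i = i) :
    ∃ j, a.node j = i := ⟨_, a.node_index i h⟩

theorem node_rev {n k : ℕ} (a : SymDangle n k) (j : Fin (2 * (n - k))) :
    a.node j.rev = (a.node j).rev :=
  orderIsoOfFin_rev _ _ (fun i hi => by rw [mem_freeNodes] at hi ⊢; rw [a.2, hi]) j

/-- The diagram with top row `a`, bottom row `b` and permutation `p`. -/
def join {n k : ℕ} (a b : SymDangle n k) (p : hyperoctahedral (n - k)) :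
    BrauerDiagram (2 * n) where
  partner := Sum.elim
    -- The permutation runs from bottom positions to top positions, so it is inverted when read from
    -- the top.
    (fun i => if h : a.1.toFun i = i then .inr (b.node (p.1⁻¹ (a.index i h)))
      else .inl (a.1.toFun i))
    (fun i => if h : b.1.toFun i = i then .inl (a.node (p.1 (b.index i h)))
      else .inr (b.1.toFun i))
  invol x := by
    rcases x with i | i
    · by_cases h : a.1.toFun i = i
      · simp [h, toFun_node, index_node, node_index]
      · simp [h, a.1.invol, Ne.symm h]
    · by_cases h : b.1.toFun i = i
      · simp [h, toFun_node, index_node, node_index]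
      · simp [h, b.1.invol, Ne.symm h]
  ne x := by
    rcases x with i | i
    · by_cases h : a.1.toFun i = i <;> simp [h]
    · by_cases h : b.1.toFun i = i <;> simp [h]

section

variable {n k : ℕ} (a b : SymDangle n k) (p : hyperoctahedral (n - k))

theorem join_partner_inr_node (j : Fin (2 * (n - k))) :
    (join a b p).partner (.inr (b.node j)) = .inl (a.node (p.1 j)) := by
  simp [join, toFun_node, index_node]

theorem join_partner_inl_node (j : Fin (2 * (n - k))) :
    (join a b p).partner (.inl (a.node j)) = .inr (b.node (p.1⁻¹ j)) := by
  simp [join, toFun_node, index_node]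

theorem topRow_join : (join a b p).topRow = a.1.toFun := by
  funext i
  by_cases h : a.1.toFun i = i <;> simp [BrauerDiagram.topRow, join, h]

theorem botRow_join : (join a b p).botRow = b.1.toFun := by
  funext i
  by_cases h : b.1.toFun i = i <;> simp [BrauerDiagram.botRow, join, h]

theorem arcs_join : (join a b p).arcs = k := by
  unfold BrauerDiagram.arcs
  rw [topRow_join, a.1.card_arcs]

variable {a b p}

/-- A diagram is determined by its two dangles and its permutation. -/
theorem eq_join {d : BrauerDiagram (2 * n)} (ht : d.topRow = a.1.toFun)
    (hb : d.botRow = b.1.toFun)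
    (hv : ∀ j, d.partner (.inr (b.node j)) = .inl (a.node (p.1 j))) : d = join a b p := by
  symm
  refine BrauerDiagram.ext_rows ?_ ?_ ?_
  · rw [topRow_join, ht]
  · rw [botRow_join, hb]
  · intro i j h
    have hi := BrauerDiagram.botRow_of_inl h
    rw [botRow_join] at hi
    obtain ⟨l, rfl⟩ := b.exists_node hi
    rw [hv, ← join_partner_inr_node a b p, h]

/-- On vertical strands, numbering the free nodes commutes with reversal (`node_rev`), and so do `p`
and its inverse, being hyperoctahedral. On arcs the symmetry is that of the dangles. -/
theorem join_isSymm : (join a b p).IsSymm := by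
  have hp := mem_hyperoctahedral.1 p.2
  have hp' := mem_hyperoctahedral.1 (p⁻¹).2
  rintro (i | i)
  · show (join a b p).partner (.inl i.rev) = _
    by_cases h : a.1.toFun i = i
    · obtain ⟨j, rfl⟩ := a.exists_node h
      have h1 : p.1⁻¹ j.rev = (p.1⁻¹ j).rev := hp' j
      rw [← node_rev, join_partner_inl_node, join_partner_inl_node, h1, node_rev]
      rfl
    · have h2 : ∀ i, a.1.toFun i ≠ i → (join a b p).partner (.inl i) = .inl (a.1.toFun i) :=
        fun i h => by simp [join, h]
      rw [h2 i h, h2 i.rev (by rw [a.2]; exact fun e => h (Fin.rev_injective e)), a.2]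
      rfl
  · show (join a b p).partner (.inr i.rev) = _
    by_cases h : b.1.toFun i = i
    · obtain ⟨j, rfl⟩ := b.exists_node h
      rw [← node_rev, join_partner_inr_node, join_partner_inr_node, hp, node_rev]
      rfl
    · have h2 : ∀ i, b.1.toFun i ≠ i → (join a b p).partner (.inr i) = .inr (b.1.toFun i) :=
        fun i h => by simp [join, h]
      rw [h2 i h, h2 i.rev (by rw [b.2]; exact fun e => h (Fin.rev_injective e)), b.2]
      rfl

end

/-- The defining property of the permutation of a diagram. -/
theorem throughPerm_spec {n k : ℕ} (d : BrauerDiagram (2 * n)) (hd : d.IsSymm) (h : d.arcs = k)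
    (j : Fin (2 * (n - k))) :
    d.partner (.inr ((d.botDangle hd h).node j)) =
      .inl ((d.topDangle hd h).node ((d.throughPerm hd h).1 j)) := by
  have h1 : (d.topDangle hd h).node ((d.throughPerm hd h).1 j) =
      (d.through ((freeNodes d.botRow).orderIsoOfFin (d.card_free_bot h) j)).1 :=
    congrArg Subtype.val (((freeNodes d.topRow).orderIsoOfFin (d.card_free_top h)).apply_symm_apply
      (d.through ((freeNodes d.botRow).orderIsoOfFin (d.card_free_bot h) j)))
  rw [h1]
  obtain ⟨l, hl⟩ := (d.mem_free_bot _).1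
    ((freeNodes d.botRow).orderIsoOfFin (d.card_free_bot h) j).2
  show d.partner (.inr ((freeNodes d.botRow).orderIsoOfFin (d.card_free_bot h) j).1) =
    .inl (Sum.elim id id (d.partner (.inr _)))
  rw [hl]
  rfl

/-- Together with `join_injective` this identifies symmetric diagrams having `k` arcs with triples
of two dangles and a permutation. -/
theorem eq_join_throughPerm {n k : ℕ} (d : BrauerDiagram (2 * n)) (hd : d.IsSymm)
    (h : d.arcs = k) :
    d = join (d.topDangle hd h) (d.botDangle hd h) (d.throughPerm hd h) :=
  eq_join rfl rfl (throughPerm_spec d hd h)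

theorem join_injective {n k : ℕ} {a b a' b' : SymDangle n k} {p p' : hyperoctahedral (n - k)}
    (h : join a b p = join a' b' p') : a = a' ∧ b = b' ∧ p = p' := by
  have ha : a = a' := ext (by rw [← topRow_join a b p, h, topRow_join])
  have hb : b = b' := ext (by rw [← botRow_join a b p, h, botRow_join])
  subst ha hb
  refine ⟨rfl, rfl, Subtype.ext (Equiv.ext fun j => ?_)⟩
  have h1 := join_partner_inr_node a b p j
  rw [h, join_partner_inr_node] at h1
  exact (a.node_injective (Sum.inl_injective h1)).symm

/-- The dangles and the permutation of a diagram, read off from a presentation as a join. -/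
theorem rows_of_eq_join {n k : ℕ} {a b : SymDangle n k} {p : hyperoctahedral (n - k)}
    {d : BrauerDiagram (2 * n)} (hd : d.IsSymm) (h : d.arcs = k) (hj : d = join a b p) :
    d.topDangle hd h = a ∧ d.botDangle hd h = b ∧ d.throughPerm hd h = p :=
  join_injective ((eq_join_throughPerm d hd h).symm.trans hj)

/-! ### Composition of joins -/

section

variable {n k : ℕ} (a b c : SymDangle n k) (p q : hyperoctahedral (n - k))

theorem diagram_eq_join : a.diagram = join a a 1 :=
  eq_join (BrauerDiagram.topRow_ofInvolution _ _) (BrauerDiagram.botRow_ofInvolution _ _)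
    fun j => BrauerDiagram.ofInvolution_partner_inr _ (a.toFun_node j)

theorem arcs_diagram : a.diagram.arcs = k := by
  rw [diagram_eq_join, arcs_join]

/-- Upside down, the vertical strands are read in the opposite direction, hence the inverse. -/
theorem flip_join : (join a b p).flip = join b a p⁻¹ := by
  refine eq_join ?_ ?_ fun j => ?_
  · rw [BrauerDiagram.topRow_flip, botRow_join]
  · rw [BrauerDiagram.botRow_flip, topRow_join]
  · rw [BrauerDiagram.flip_partner, Sum.swap_inr, join_partner_inl_node]
    rfl

theorem loops_join : BrauerDiagram.loops (join a b p) (join b c q) = k := by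
  rw [BrauerDiagram.loops_of_extends, arcs_join]
  intro i _
  rw [topRow_join, botRow_join]

/-- With equal middle rows each vertical strand crosses exactly one middle node: position `j` goes
to `q j`, then to `p (q j)`. No new arcs arise, so the outer rows are kept. -/
theorem join_comp_join : (join a b p).comp (join b c q) = join a c (p * q) := by
  have harcs : ((join a b p).comp (join b c q)).arcs = k := by
    rw [BrauerDiagram.arcs_comp_of_eq, arcs_join]
    rw [topRow_join, botRow_join]
  refine eq_join ?_ ?_ fun j => ?_
  · rw [BrauerDiagram.topRow_comp_of_arcs_eq, topRow_join]
    rw [harcs, arcs_join]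
  · rw [BrauerDiagram.botRow_comp_of_arcs_eq, botRow_join]
    rw [harcs, arcs_join]
  · exact BrauerDiagram.comp_partner_through (join_partner_inr_node b c q j)
      (join_partner_inr_node a b p _)

variable {a b}

/-- The composite of the diagrams of two dangles, when no new arcs are formed. -/
theorem diagram_comp_diagram (h : (a.diagram.comp b.diagram).arcs = k) :
    a.diagram.comp b.diagram =
      join a b ((a.diagram.comp b.diagram).throughPerm
        (a.diagram_isSymm.comp b.diagram_isSymm) h) := by
  have ht : (a.diagram.comp b.diagram).topRow = a.1.toFun := by
    rw [BrauerDiagram.topRow_comp_of_arcs_eq (by rw [h, arcs_diagram]), diagram_eq_join,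
      topRow_join]
  have hb : (a.diagram.comp b.diagram).botRow = b.1.toFun := by
    rw [BrauerDiagram.botRow_comp_of_arcs_eq (by rw [h, arcs_diagram]), diagram_eq_join b,
      botRow_join]
  have h1 := eq_join_throughPerm _ (a.diagram_isSymm.comp b.diagram_isSymm) h
  have h2 : (a.diagram.comp b.diagram).topDangle
      (a.diagram_isSymm.comp b.diagram_isSymm) h = a := ext ht
  have h3 : (a.diagram.comp b.diagram).botDangle
      (a.diagram_isSymm.comp b.diagram_isSymm) h = b := ext hb
  rwa [h2, h3] at h1

variable (a b)
variable (b' : SymDangle n k)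

/-- The product of two joins is governed by the product of the diagrams of the two dangles facing
each other. -/
theorem join_comp_eq :
    (join a b p).comp (join b' c q) =
        (join a b p).comp ((b.diagram.comp b'.diagram).comp (join b' c q)) ∧
      BrauerDiagram.loops b.diagram b'.diagram +
          BrauerDiagram.loops (b.diagram.comp b'.diagram) (join b' c q) +
          BrauerDiagram.loops (join a b p) ((b.diagram.comp b'.diagram).comp (join b' c q)) =
        k + k + BrauerDiagram.loops (join a b p) (join b' c q) := by
  -- Two reassociations: `b'.diagram` is absorbed by the lower join and `b.diagram` by the upper
  -- one, with `k` loops each time. Adding the two loop identities gives the count.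
  have h1 := BrauerDiagram.comp_assoc_aux b.diagram b'.diagram (join b' c q)
  have h2 := BrauerDiagram.comp_assoc_aux (join a b p) b.diagram (join b' c q)
  have e1 : b'.diagram.comp (join b' c q) = join b' c q := by
    rw [diagram_eq_join, join_comp_join, one_mul]
  have e2 : (join a b p).comp b.diagram = join a b p := by
    rw [diagram_eq_join, join_comp_join, mul_one]
  have l1 : BrauerDiagram.loops b'.diagram (join b' c q) = k := by
    rw [diagram_eq_join, loops_join]
  have l2 : BrauerDiagram.loops (join a b p) b.diagram = k := by
    rw [diagram_eq_join, loops_join]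
  rw [e1, l1] at h1
  rw [e2, l2] at h2
  refine ⟨by rw [h1.2, h2.2], ?_⟩
  rw [h1.2]
  have := h1.1
  have := h2.1
  omega

/-- The product vanishes in the layer exactly when the form does on `b` and `b'`. Arcs never
decrease, so the number of arcs of the inner composite lies between `k` and that of the full
composite; conversely, an inner composite without new arcs is itself a join. -/
theorem arcs_join_comp_iff : ((join a b p).comp (join b' c q)).arcs = k ↔
    (b.diagram.comp b'.diagram).arcs = k := by
  have h1 := (join_comp_eq a b c p q b').1
  constructor
  · intro h
    refine le_antisymm ?_ (b.arcs_diagram.ge.trans (BrauerDiagram.arcs_le_comp_left _ _))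
    rw [h1] at h
    calc _ ≤ _ := BrauerDiagram.arcs_le_comp_left _ (join b' c q)
      _ ≤ _ := BrauerDiagram.arcs_le_comp_right (join a b p) _
      _ = k := h
  · intro h
    rw [h1, diagram_comp_diagram h, join_comp_join, join_comp_join, arcs_join]

/-- Once the inner composite is a join of `b` and `b'`, all middle rows match. The two inserted
dangles cost `2k` loops and the two matched compositions create `2k`, so these cancel. -/
theorem join_comp_join_of_arcs (h : (b.diagram.comp b'.diagram).arcs = k) :
    (join a b p).comp (join b' c q) = join a c (p * ((b.diagram.comp b'.diagram).throughPerm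
        (b.diagram_isSymm.comp b'.diagram_isSymm) h) * q) ∧
      BrauerDiagram.loops (join a b p) (join b' c q) =
        BrauerDiagram.loops b.diagram b'.diagram := by
  have h1 := join_comp_eq a b c p q b'
  -- Naming the permutation keeps the composite from reappearing on the right-hand side of `h2`.
  generalize hr : (b.diagram.comp b'.diagram).throughPerm _ h = r
  have h2 := diagram_comp_diagram h
  rw [hr] at h2
  rw [h2, join_comp_join, join_comp_join, loops_join, loops_join] at h1
  refine ⟨by rw [h1.1, mul_assoc], ?_⟩
  have := h1.2
  omega

end

end SymDangle

/-! ### Symmetry of the bilinear form -/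

theorem invMap_add {R : Type*} [CommRing R] {m : ℕ} (x y : HypAlgebra R m) :
    invMap R m (x + y) = invMap R m x + invMap R m y :=
  MonoidAlgebra.mapDomain_add _ x y

theorem invMap_zero {R : Type*} [CommRing R] {m : ℕ} : invMap R m 0 = 0 :=
  MonoidAlgebra.mapDomain_zero _

theorem invMap_smul {R : Type*} [CommRing R] {m : ℕ} (r : R) (x : HypAlgebra R m) :
    invMap R m (r • x) = r • invMap R m x :=
  MonoidAlgebra.mapDomain_smul _ r x

theorem invMap_of {R : Type*} [CommRing R] {m : ℕ} (p : hyperoctahedral m) :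
    invMap R m (MonoidAlgebra.of R _ p) = MonoidAlgebra.of R _ p⁻¹ := by
  simp [invMap, MonoidAlgebra.of_apply]

/-- Flipping fixes D_f and D_g and reverses their product, preserving loops and arcs; by `flip_join`
it inverts the permutation. -/
theorem invMap_formValue {R : Type*} [CommRing R] (δ : Rˣ) (n k : ℕ) (f g : SymDangle n k) :
    invMap R (n - k) (formValue δ n k f g) = formValue δ n k g f := by
  have hf : f.diagram.flip = f.diagram := BrauerDiagram.flip_ofInvolution _ _
  have hg : g.diagram.flip = g.diagram := BrauerDiagram.flip_ofInvolution _ _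
  have hfg := BrauerDiagram.flip_comp_aux f.diagram g.diagram
  rw [hf, hg] at hfg
  have hiff : (g.diagram.comp f.diagram).arcs = k ↔ (f.diagram.comp g.diagram).arcs = k := by
    rw [hfg.2, BrauerDiagram.arcs_flip]
  unfold formValue
  by_cases h : (f.diagram.comp g.diagram).arcs = k
  · rw [dif_pos h, dif_pos (hiff.2 h), invMap_smul, invMap_of, hfg.1]
    congr 2
    have h1 := SymDangle.diagram_comp_diagram h
    have h2 := SymDangle.diagram_comp_diagram (hiff.2 h)
    have h3 := (congrArg BrauerDiagram.flip h1).trans (SymDangle.flip_join _ _ _)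
    exact (SymDangle.join_injective (h3.symm.trans (hfg.2.symm.trans h2))).2.2
  · rw [dif_neg h, dif_neg fun h' => h (hiff.1 h'), invMap_zero]

theorem form_single {R : Type*} [CommRing R] (δ : Rˣ) (n k : ℕ) (f g : SymDangle n k) (r s : R) :
    form δ n k (Finsupp.single f r) (Finsupp.single g s) = r • s • formValue δ n k f g := by
  simp [form]

theorem invMap_form {R : Type*} [CommRing R] (δ : Rˣ) (n k : ℕ) (v w : DangleModule R n k) :
    invMap R (n - k) (form δ n k v w) = form δ n k w v := by
  induction v using Finsupp.induction_linear with
  | zero => rw [map_zero, map_zero, LinearMap.zero_apply, invMap_zero]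
  | add v v' h h' => rw [map_add, map_add, LinearMap.add_apply, invMap_add, h, h']
  | single f r =>
    induction w using Finsupp.induction_linear with
    | zero => rw [map_zero, map_zero, LinearMap.zero_apply, invMap_zero]
    | add w w' h h' => rw [map_add, map_add, LinearMap.add_apply, invMap_add, h, h']
    | single g s =>
      rw [form_single, form_single, invMap_smul, invMap_smul, invMap_formValue, smul_comm]

/-! ### The ideals -/

theorem symOf_mul_symOf {R : Type*} [CommRing R] (δ : R) {n : ℕ} {d e : BrauerDiagram (2 * n)}
    (hd : d.IsSymm) (he : e.IsSymm) :
    symOf δ d hd * symOf δ e he = δ ^ BrauerDiagram.loops d e • symOf δ (d.comp e) (hd.comp he) :=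
  Subtype.ext (BrauerAlgebra.of_mul_of δ d e)

/-- The span of the symmetric diagrams with at least `i` arcs in each row. -/
noncomputable def arcSpan {R : Type*} [CommRing R] (δ : R) (n i : ℕ) : Submodule R (typeC δ n) :=
  Submodule.span R {x | ∃ (d : BrauerDiagram (2 * n)) (hd : d.IsSymm), i ≤ d.arcs ∧
    symOf δ d hd = x}

section

variable {R : Type*} [CommRing R] {δ : R} {n i j : ℕ}

theorem symOf_mem_arcSpan {d : BrauerDiagram (2 * n)} (hd : d.IsSymm) (h : i ≤ d.arcs) :
    symOf δ d hd ∈ arcSpan δ n i := Submodule.subset_span ⟨d, hd, h, rfl⟩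

/-- Diagrams form a basis of the ambient Brauer algebra, where a span of diagrams is a condition on
supports. An element of `typeC` has symmetric support, so adding the condition on arcs places it in
the image of `arcSpan`. -/
theorem mem_arcSpan {x : typeC δ n} : x ∈ arcSpan δ n i ↔
    ∀ d : BrauerDiagram (2 * n),
      BrauerAlgebra.coeff (x : BrauerAlgebra δ (2 * n)) d ≠ 0 → i ≤ d.arcs := by
  have hsupp : ∀ (S : Set (BrauerDiagram (2 * n))) (y : BrauerAlgebra δ (2 * n)),
      y ∈ Submodule.span R (BrauerAlgebra.of δ '' S) ↔
        ∀ d, BrauerAlgebra.coeff y d ≠ 0 → d ∈ S := by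
    intro S y
    refine (Iff.of_eq (congrArg (y ∈ ·) (Finsupp.supported_eq_span_single R S).symm)).trans ?_
    refine (Finsupp.mem_supported (M := R) R y).trans ?_
    constructor
    · exact fun h d hd => h (Finsupp.mem_support_iff.2 hd)
    · exact fun h d hd => h d (Finsupp.mem_support_iff.1 hd)
  have hsymm : ∀ d, BrauerAlgebra.coeff (x : BrauerAlgebra δ (2 * n)) d ≠ 0 → d.IsSymm := by
    refine (hsupp {d | d.IsSymm} x.1).1 ?_
    have hx := x.2
    rw [Set.image_eq_range]
    exact hx
  constructor
  · intro hx
    refine (hsupp {d | i ≤ d.arcs} x.1).1 ?_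
    have hle : arcSpan δ n i ≤ (Submodule.span R (BrauerAlgebra.of δ '' {d | i ≤ d.arcs})).comap
        (typeC δ n).val.toLinearMap := by
      refine Submodule.span_le.2 ?_
      rintro _ ⟨d, hd, h, rfl⟩
      exact Submodule.subset_span ⟨d, h, rfl⟩
    exact hle hx
  · intro hx
    have h1 := (hsupp {d | d.IsSymm ∧ i ≤ d.arcs} x.1).2 fun d hd => ⟨hsymm d hd, hx d hd⟩
    have h2 : Submodule.span R (BrauerAlgebra.of δ '' {d | d.IsSymm ∧ i ≤ d.arcs}) ≤
        (arcSpan δ n i).map (typeC δ n).val.toLinearMap := by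
      refine Submodule.span_le.2 ?_
      rintro _ ⟨d, hd, rfl⟩
      exact ⟨symOf δ d hd.1, symOf_mem_arcSpan hd.1 hd.2, rfl⟩
    obtain ⟨y, hy, hyx⟩ := h2 h1
    rwa [← show y = x from Subtype.ext hyx]

theorem mem_arcSpan_zero (x : typeC δ n) : x ∈ arcSpan δ n 0 :=
  mem_arcSpan.2 fun _ _ => Nat.zero_le _

/-- The arcs of both factors survive. Taking one index to be `0`, where the span is everything,
gives the ideal property. -/
theorem mul_mem_arcSpan {x y : typeC δ n} (hx : x ∈ arcSpan δ n i) (hy : y ∈ arcSpan δ n j) :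
    x * y ∈ arcSpan δ n (max i j) := by
  induction hx using Submodule.span_induction with
  | zero => rw [zero_mul]; exact Submodule.zero_mem _
  | add x x' _ _ h h' => rw [add_mul]; exact Submodule.add_mem _ h h'
  | smul r x _ h => rw [smul_mul_assoc]; exact Submodule.smul_mem _ _ h
  | mem x hx =>
    obtain ⟨d, hd, hdi, rfl⟩ := hx
    induction hy using Submodule.span_induction with
    | zero => rw [mul_zero]; exact Submodule.zero_mem _
    | add y y' _ _ h h' => rw [mul_add]; exact Submodule.add_mem _ h h'
    | smul r y _ h => rw [mul_smul_comm]; exact Submodule.smul_mem _ _ h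
    | mem y hy =>
      obtain ⟨e, he, hej, rfl⟩ := hy
      rw [symOf_mul_symOf]
      exact Submodule.smul_mem _ _ (symOf_mem_arcSpan _
        (max_le (hdi.trans (BrauerDiagram.arcs_le_comp_left d e))
          (hej.trans (BrauerDiagram.arcs_le_comp_right d e))))

theorem arcSpan_anti (h : i ≤ j) : arcSpan δ n j ≤ arcSpan δ n i := fun _ hx =>
  mem_arcSpan.2 fun d hd => h.trans (mem_arcSpan.1 hx d hd)

end

theorem numArcs_nestedArcs {n k : ℕ} (hk : k ≤ n) : numArcs (nestedArcs n k) = k := by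
  -- The left ends of the nested arcs are the `k` positions just left of the axis.
  have hlt : ∀ i : Fin (2 * n), i < nestedArcs n k i ↔ n - k ≤ i.1 ∧ i.1 < n := by
    intro i
    have := i.2
    unfold nestedArcs
    split_ifs with h
    · rw [Fin.lt_def, Fin.val_rev]; omega
    · simp only [lt_self_iff_false, false_iff]; omega
  unfold numArcs
  have h1 : ((Finset.univ.filter fun i : Fin (2 * n) => i < nestedArcs n k i).map
      Fin.valEmbedding) = Finset.Ico (n - k) n := by
    ext l
    simp only [Finset.mem_map, Finset.mem_filter, Finset.mem_univ, true_and, hlt,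
      Fin.valEmbedding_apply, Finset.mem_Ico]
    constructor
    · rintro ⟨i, hi, rfl⟩; exact hi
    · intro hl; exact ⟨⟨l, by omega⟩, hl, rfl⟩
  rw [← Finset.card_map Fin.valEmbedding, h1, Nat.card_Ico]
  omega

/-- The dangle of `k` nested symmetric arcs. -/
def nestedDangle {n k : ℕ} (hk : k ≤ n) : SymDangle n k :=
  ⟨⟨nestedArcs n k, nestedArcs_invol n k, numArcs_nestedArcs hk⟩, nestedArcs_rev n k⟩

theorem nestedArcs_extends {n i j : ℕ} (hij : i ≤ j) (hj : j ≤ n) (l : Fin (2 * n))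
    (h : nestedArcs n i l ≠ l) : nestedArcs n j l = nestedArcs n i l := by
  unfold nestedArcs at *
  split_ifs at * <;> first | rfl | omega

theorem arcs_le {n : ℕ} (d : BrauerDiagram (2 * n)) : d.arcs ≤ n := by
  have h1 := card_freeNodes _ d.topRow_invol
  unfold BrauerDiagram.arcs
  omega

section

variable {R : Type*} [CommRing R] {δ : Rˣ} {n i k : ℕ}

theorem smul_mem_layerIdeal (r : R) {x : typeC (δ : R) n} (hx : x ∈ layerIdeal δ n i) :
    r • x ∈ layerIdeal δ n i := (idealAlgebra R (layerIdeal δ n i)).smul_mem r hx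

/-- The diagram factors through one with nested top row, which f_i fixes; the loops that are closed
on the way contribute only powers of the unit δ. -/
theorem symOf_mem_layerIdeal {d : BrauerDiagram (2 * n)} (hd : d.IsSymm) (h : i ≤ d.arcs) :
    symOf (δ : R) d hd ∈ layerIdeal δ n i := by
  let c : SymDangle n d.arcs := nestedDangle (arcs_le d)
  let a := d.topDangle hd rfl
  let b := d.botDangle hd rfl
  let p : hyperoctahedral (n - d.arcs) := d.throughPerm hd rfl
  have hj : d = SymDangle.join a b p := SymDangle.eq_join_throughPerm d hd rfl
  let e := SymDangle.join c b p
  have he : e.IsSymm := SymDangle.join_isSymm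
  have htop : ∀ l, nestedArcs n i l ≠ l → e.topRow l = nestedArcs n i l := by
    intro l hl
    rw [SymDangle.topRow_join]
    exact nestedArcs_extends h (arcs_le d) l hl
  -- The `i` arcs of f_i match arcs of `e` and close `i` loops, which cancel the factor `δ⁻¹ ^ i`.
  have h1 : idem δ n i * symOf (δ : R) e he = symOf (δ : R) e he := by
    unfold idem
    rw [smul_mul_assoc, symOf_mul_symOf, smul_smul]
    have h2 : BrauerDiagram.loops
        (BrauerDiagram.ofInvolution (nestedArcs n i) (nestedArcs_invol n i)) e = i := by
      rw [BrauerDiagram.loops_of_extends, BrauerDiagram.arcs_ofInvolution,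
        numArcs_nestedArcs (h.trans (arcs_le d))]
      rwa [BrauerDiagram.botRow_ofInvolution]
    have h3 := BrauerDiagram.ofInvolution_comp (nestedArcs_invol n i) htop
    simp only [h2, h3]
    rw [← Units.val_pow_eq_pow_val, ← Units.val_mul, ← mul_pow, inv_mul_cancel, one_pow,
      Units.val_one, one_smul]
  have h4 : idem δ n i ∈ layerIdeal δ n i :=
    -- A diagram on `2n` nodes has at most `n` arcs, so `i ≤ n` is automatic and the range `i > n`
    -- needs no separate case.
    TwoSidedIdeal.subset_span ⟨h.trans (arcs_le d), rfl⟩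
  have h5 : symOf (δ : R) e he ∈ layerIdeal δ n i := by
    rw [← h1]
    exact (layerIdeal δ n i).mul_mem_right _ _ h4
  -- Exchanging the nested top row for `a` closes `d.arcs` loops and yields `δ ^ d.arcs` times `d`;
  -- the power is then divided out.
  have h6 := (layerIdeal δ n i).mul_mem_left
    (symOf (δ : R) (SymDangle.join a c 1) SymDangle.join_isSymm) _ h5
  rw [symOf_mul_symOf] at h6
  simp only [e, SymDangle.loops_join, SymDangle.join_comp_join, one_mul, ← hj] at h6
  have h7 := smul_mem_layerIdeal ((δ⁻¹ ^ d.arcs : Rˣ) : R) h6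
  rwa [smul_smul, ← Units.val_pow_eq_pow_val, ← Units.val_mul, ← mul_pow, inv_mul_cancel, one_pow,
      Units.val_one, one_smul] at h7

theorem mem_layerIdeal_iff {x : typeC (δ : R) n} :
    x ∈ layerIdeal δ n i ↔ x ∈ arcSpan (δ : R) n i := by
  constructor
  · intro hx
    let I : TwoSidedIdeal (typeC (δ : R) n) := TwoSidedIdeal.mk' (arcSpan (δ : R) n i)
      (Submodule.zero_mem _) (Submodule.add_mem _) (Submodule.neg_mem _)
      (fun hy => arcSpan_anti (le_max_right 0 i) (mul_mem_arcSpan (mem_arcSpan_zero _) hy))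
      (fun hx => arcSpan_anti (le_max_left i 0) (mul_mem_arcSpan hx (mem_arcSpan_zero _)))
    have hle : layerIdeal δ n i ≤ I := by
      refine TwoSidedIdeal.span_le.2 ?_
      rintro _ ⟨hi, rfl⟩
      refine (TwoSidedIdeal.mem_mk' _ _ _ _ _ _ _).2 (Submodule.smul_mem _ _ ?_)
      refine symOf_mem_arcSpan _ ?_
      rw [BrauerDiagram.arcs_ofInvolution, numArcs_nestedArcs hi]
    exact (TwoSidedIdeal.mem_mk' _ _ _ _ _ _ _).1 (hle hx)
  · intro hx
    induction hx using Submodule.span_induction with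
    | zero => exact (layerIdeal δ n i).zero_mem
    | add x x' _ _ h h' => exact (layerIdeal δ n i).add_mem h h'
    | smul r x _ h => exact smul_mem_layerIdeal r h
    | mem x hx =>
      obtain ⟨d, hd, hdi, rfl⟩ := hx
      exact symOf_mem_layerIdeal hd hdi

end

/-! ### The layers as inflations -/

section

variable {R : Type*} [CommRing R] (δ : Rˣ) (n k : ℕ)

/-- The basis element of the inflation given by two dangles and a permutation. -/
noncomputable def inflationBasis (a b : SymDangle n k) (p : hyperoctahedral (n - k)) :
    Inflation (form δ n k) :=
  Inflation.tmul (form δ n k) (Finsupp.single a 1) (Finsupp.single b 1) (MonoidAlgebra.of R _ p)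

open Classical in
/-- The linear map sending a symmetric diagram with exactly `k` arcs in each row to the tensor
product of its dangles and its permutation, and all other diagrams to zero. -/
noncomputable def toInflation : typeC (δ : R) n →ₗ[R] Inflation (form δ n k) :=
  (Finsupp.linearCombination R fun d : BrauerDiagram (2 * n) =>
    if h : d.IsSymm ∧ d.arcs = k then inflationBasis δ n k (d.topDangle h.1 h.2)
      (d.botDangle h.1 h.2) (d.throughPerm h.1 h.2) else 0 :
    BrauerAlgebra (δ : R) (2 * n) →ₗ[R] Inflation (form δ n k)) ∘ₗ
    (typeC (δ : R) n).val.toLinearMap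

open scoped TensorProduct in
/-- The linear map sending two dangles and a permutation to the corresponding diagram. -/
noncomputable def ofInflation : Inflation (form δ n k) →ₗ[R] typeC (δ : R) n :=
  (TensorProduct.lift (TensorProduct.lift
    (Finsupp.linearCombination R fun a => Finsupp.linearCombination R fun b =>
      (Finsupp.linearCombination R fun p =>
        symOf (δ : R) (SymDangle.join a b p) SymDangle.join_isSymm) ∘ₗ
        (MonoidAlgebra.coeffLinearEquiv R).toLinearMap)) :
    (DangleModule R n k ⊗[R] DangleModule R n k) ⊗[R] HypAlgebra R (n - k) →ₗ[R] typeC (δ : R) n)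

variable {δ n k}

theorem toInflation_symOf {d : BrauerDiagram (2 * n)} (hd : d.IsSymm) (h : d.arcs = k) :
    toInflation δ n k (symOf (δ : R) d hd) =
      inflationBasis δ n k (d.topDangle hd h) (d.botDangle hd h) (d.throughPerm hd h) := by
  refine (Finsupp.linearCombination_single R (1 : R) d).trans ?_
  rw [one_smul, dif_pos ⟨hd, h⟩]

theorem toInflation_symOf_of_ne {d : BrauerDiagram (2 * n)} (hd : d.IsSymm) (h : d.arcs ≠ k) :
    toInflation δ n k (symOf (δ : R) d hd) = 0 := by
  refine (Finsupp.linearCombination_single R (1 : R) d).trans ?_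
  rw [one_smul, dif_neg fun h' => h h'.2]

theorem toInflation_join {a b : SymDangle n k} {p : hyperoctahedral (n - k)}
    {d : BrauerDiagram (2 * n)} (hd : d.IsSymm) (h : d = SymDangle.join a b p) :
    toInflation δ n k (symOf (δ : R) d hd) = inflationBasis δ n k a b p := by
  have harcs : d.arcs = k := by rw [h, SymDangle.arcs_join]
  obtain ⟨h1, h2, h3⟩ := SymDangle.rows_of_eq_join hd harcs h
  rw [toInflation_symOf hd harcs, h1, h2, h3]

theorem ofInflation_basis (a b : SymDangle n k) (p : hyperoctahedral (n - k)) :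
    ofInflation δ n k (inflationBasis δ n k a b p) =
      symOf (δ : R) (SymDangle.join a b p) SymDangle.join_isSymm := by
  unfold ofInflation inflationBasis Inflation.tmul
  erw [TensorProduct.lift.tmul, TensorProduct.lift.tmul]
  simp [MonoidAlgebra.of_apply]

/-- All three tensor factors are free on dangles or permutations, so linear statements about the
inflation may be checked on triples. -/
theorem span_inflationBasis (t : Inflation (form δ n k)) :
    t ∈ Submodule.span R {t | ∃ a b p, inflationBasis δ n k a b p = t} := by
  induction t using Inflation.induction_tmul with
  | h0 => exact Submodule.zero_mem _
  | hadd s t hs ht => exact Submodule.add_mem _ hs ht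
  | htmul a b x =>
    unfold Inflation.tmul
    induction a using Finsupp.induction_linear with
    | zero => rw [TensorProduct.zero_tmul, TensorProduct.zero_tmul]; exact Submodule.zero_mem _
    | add a a' h h' =>
      rw [TensorProduct.add_tmul, TensorProduct.add_tmul]; exact Submodule.add_mem _ h h'
    | single a r =>
      induction b using Finsupp.induction_linear with
      | zero => rw [TensorProduct.tmul_zero, TensorProduct.zero_tmul]; exact Submodule.zero_mem _
      | add b b' h h' =>
        rw [TensorProduct.tmul_add, TensorProduct.add_tmul]; exact Submodule.add_mem _ h h'
      | single b s =>
        induction x using MonoidAlgebra.induction_linear with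
        | zero => rw [TensorProduct.tmul_zero]; exact Submodule.zero_mem _
        | add x x' h h' => rw [TensorProduct.tmul_add]; exact Submodule.add_mem _ h h'
        | single p q =>
          have h1 : (Finsupp.single a r : DangleModule R n k) = r • Finsupp.single a 1 := by simp
          have h2 : (Finsupp.single b s : DangleModule R n k) = s • Finsupp.single b 1 := by simp
          have h3 : (MonoidAlgebra.single p q : HypAlgebra R (n - k)) =
              q • MonoidAlgebra.of R _ p := by simp [MonoidAlgebra.of_apply]
          rw [h1, h2, h3, TensorProduct.tmul_smul, TensorProduct.tmul_smul,
            ← TensorProduct.smul_tmul', ← TensorProduct.smul_tmul', ← TensorProduct.smul_tmul']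
          exact Submodule.smul_mem _ _ (Submodule.smul_mem _ _ (Submodule.smul_mem _ _
            (Submodule.subset_span ⟨a, b, p, rfl⟩)))

theorem ofInflation_mem (t : Inflation (form δ n k)) :
    ofInflation δ n k t ∈ arcSpan (δ : R) n k := by
  induction span_inflationBasis t using Submodule.span_induction with
  | zero => rw [map_zero]; exact Submodule.zero_mem _
  | add s t _ _ h h' => rw [map_add]; exact Submodule.add_mem _ h h'
  | smul r t _ h => rw [map_smul]; exact Submodule.smul_mem _ _ h
  | mem t ht =>
    obtain ⟨a, b, p, rfl⟩ := ht
    rw [ofInflation_basis]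
    exact symOf_mem_arcSpan _ (SymDangle.arcs_join a b p).ge

theorem toInflation_ofInflation (t : Inflation (form δ n k)) :
    toInflation δ n k (ofInflation δ n k t) = t := by
  induction span_inflationBasis t using Submodule.span_induction with
  | zero => rw [map_zero, map_zero]
  | add s t _ _ h h' => rw [map_add, map_add, h, h']
  | smul r t _ h => rw [map_smul, map_smul, h]
  | mem t ht =>
    obtain ⟨a, b, p, rfl⟩ := ht
    rw [ofInflation_basis, toInflation_join _ rfl]

/-- Diagrams with exactly `k` arcs are recovered from their triples and only those with more arcs
are lost. This is the source of injectivity on the layer. -/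
theorem ofInflation_toInflation {x : typeC (δ : R) n} (hx : x ∈ arcSpan (δ : R) n k) :
    x - ofInflation δ n k (toInflation δ n k x) ∈ arcSpan (δ : R) n (k + 1) := by
  induction hx using Submodule.span_induction with
  | zero => rw [map_zero, map_zero, sub_zero]; exact Submodule.zero_mem _
  | add x y _ _ h h' => rw [map_add, map_add, add_sub_add_comm]; exact Submodule.add_mem _ h h'
  | smul r x _ h => rw [map_smul, map_smul, ← smul_sub]; exact Submodule.smul_mem _ _ h
  | mem x hx =>
    obtain ⟨d, hd, hdk, rfl⟩ := hx
    by_cases h : d.arcs = k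
    · rw [toInflation_symOf hd h, ofInflation_basis]
      have h1 := SymDangle.eq_join_throughPerm d hd h
      simp only [← h1, sub_self]
      exact Submodule.zero_mem _
    · rw [toInflation_symOf_of_ne hd h, map_zero, sub_zero]
      exact symOf_mem_arcSpan hd (by omega)

theorem toInflation_eq_zero {x : typeC (δ : R) n} (hx : x ∈ arcSpan (δ : R) n (k + 1)) :
    toInflation δ n k x = 0 := by
  induction hx using Submodule.span_induction with
  | zero => rw [map_zero]
  | add x y _ _ h h' => rw [map_add, h, h', add_zero]
  | smul r x _ h => rw [map_smul, h, smul_zero]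
  | mem x hx =>
    obtain ⟨d, hd, hdk, rfl⟩ := hx
    exact toInflation_symOf_of_ne hd (by omega)

/-! ### Multiplicativity of the map to the inflation -/

theorem Inflation.tmul_smul_right (a b : DangleModule R n k) (r : R) (x : HypAlgebra R (n - k)) :
    Inflation.tmul (form δ n k) a b (r • x) = r • Inflation.tmul (form δ n k) a b x :=
  TensorProduct.tmul_smul r _ x

theorem Inflation.tmul_zero_right (a b : DangleModule R n k) : Inflation.tmul (form δ n k) a b 0 = 0 :=
  TensorProduct.tmul_zero _ _

theorem inflationBasis_mul (a b b' c : SymDangle n k) (p q : hyperoctahedral (n - k)) :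
    inflationBasis δ n k a b p * inflationBasis δ n k b' c q =
      Inflation.tmul (form δ n k) (Finsupp.single a 1) (Finsupp.single c 1)
        (MonoidAlgebra.of R _ p * formValue δ n k b b' * MonoidAlgebra.of R _ q) := by
  unfold inflationBasis
  rw [Inflation.tmul_mul_tmul, form_single, one_smul, one_smul]

/-- The two cases of `formValue` are the two possible fates of the product: without new arcs, loops
and permutation are those of the inner composite; with new arcs, the product is killed by
`toInflation`. -/
theorem toInflation_mul_join (a b b' c : SymDangle n k) (p q : hyperoctahedral (n - k)) :
    toInflation δ n k (symOf (δ : R) (SymDangle.join a b p) SymDangle.join_isSymm *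
        symOf (δ : R) (SymDangle.join b' c q) SymDangle.join_isSymm) =
      inflationBasis δ n k a b p * inflationBasis δ n k b' c q := by
  rw [symOf_mul_symOf, map_smul, inflationBasis_mul]
  unfold formValue
  by_cases h : (b.diagram.comp b'.diagram).arcs = k
  · obtain ⟨h1, h2⟩ := SymDangle.join_comp_join_of_arcs a b c p q b' h
    rw [dif_pos h, toInflation_join _ h1, h2, mul_smul_comm, smul_mul_assoc,
      ← MonoidHom.map_mul, ← MonoidHom.map_mul]
    exact (Inflation.tmul_smul_right _ _ _ _).symm
  · rw [dif_neg h, toInflation_symOf_of_ne _ (mt (SymDangle.arcs_join_comp_iff a b c p q b').1 h),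
      mul_zero, zero_mul, smul_zero]
    exact (Inflation.tmul_zero_right _ _).symm

/-- The restriction to `arcSpan` matters: a product of diagrams with fewer than `k` arcs may have
exactly `k`. If a factor has more than `k` arcs, then so does the product, and both sides vanish. -/
theorem toInflation_mul {x y : typeC (δ : R) n} (hx : x ∈ arcSpan (δ : R) n k)
    (hy : y ∈ arcSpan (δ : R) n k) :
    toInflation δ n k (x * y) = toInflation δ n k x * toInflation δ n k y := by
  induction hx using Submodule.span_induction with
  | zero => rw [zero_mul, map_zero, zero_mul]
  | add x x' _ _ h h' => rw [add_mul, map_add, h, h', map_add, add_mul]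
  | smul r x _ h => rw [smul_mul_assoc, map_smul, h, map_smul, smul_mul_assoc]
  | mem x hx =>
    obtain ⟨d, hd, hdk, rfl⟩ := hx
    induction hy using Submodule.span_induction with
    | zero => rw [mul_zero, map_zero, mul_zero]
    | add y y' _ _ h h' => rw [mul_add, map_add, h, h', map_add, mul_add]
    | smul r y _ h => rw [mul_smul_comm, map_smul, h, map_smul, mul_smul_comm]
    | mem y hy =>
      obtain ⟨e, he, hek, rfl⟩ := hy
      have hle := BrauerDiagram.arcs_le_comp_left d e
      have hle' := BrauerDiagram.arcs_le_comp_right d e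
      by_cases h : d.arcs = k
      · by_cases h' : e.arcs = k
        · rw [toInflation_symOf hd h, toInflation_symOf he h', ← toInflation_mul_join]
          simp only [← SymDangle.eq_join_throughPerm]
        · rw [toInflation_symOf_of_ne he h', mul_zero, symOf_mul_symOf, map_smul,
            toInflation_symOf_of_ne _ (by omega), smul_zero]
      · rw [toInflation_symOf_of_ne hd h, zero_mul, symOf_mul_symOf, map_smul,
          toInflation_symOf_of_ne _ (by omega), smul_zero]

/-! ### Descent to the subquotient J_k / J_{k+1} -/

theorem exists_layerMk_eq (y : layer δ n k) :
    ∃ (x : typeC (δ : R) n) (hx : x ∈ layerIdeal δ n k), layerMk δ n k x hx = y := by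
  obtain ⟨y, x, hx, rfl⟩ := y
  exact ⟨x, hx, rfl⟩

theorem layerMk_eq_iff {x y : typeC (δ : R) n} (hx : x ∈ layerIdeal δ n k)
    (hy : y ∈ layerIdeal δ n k) :
    layerMk δ n k x hx = layerMk δ n k y hy ↔ x - y ∈ arcSpan (δ : R) n (k + 1) := by
  rw [← mem_layerIdeal_iff, ← TwoSidedIdeal.rel_iff, ← RingCon.eq]
  exact Subtype.ext_iff

variable (δ n k)

/-- The map from a layer to the inflation. -/
noncomputable def layerFun (y : layer δ n k) : Inflation (form δ n k) :=
  toInflation δ n k (exists_layerMk_eq y).choose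

variable {δ n k}

/-- The chosen representative differs from `x` by a combination of diagrams with more than `k` arcs,
on which `toInflation` vanishes. So the value does not depend on the choice. -/
theorem layerFun_layerMk {x : typeC (δ : R) n} (hx : x ∈ layerIdeal δ n k) :
    layerFun δ n k (layerMk δ n k x hx) = toInflation δ n k x := by
  obtain ⟨hx', h⟩ := (exists_layerMk_eq (layerMk δ n k x hx)).choose_spec
  rw [← sub_eq_zero]
  refine (map_sub _ _ _).symm.trans (toInflation_eq_zero ?_)
  exact (layerMk_eq_iff hx' hx).1 h

variable (δ n k)

/-- The isomorphism from a layer to the inflation. -/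
noncomputable def layerHom : layer δ n k →ₙₐ[R] Inflation (form δ n k) where
  toFun := layerFun δ n k
  map_smul' r y := by
    obtain ⟨x, hx, rfl⟩ := exists_layerMk_eq y
    have h := smul_mem_layerIdeal r hx
    rw [show r • layerMk δ n k x hx = layerMk δ n k (r • x) h from
      Subtype.ext (map_smul _ r x).symm]
    simp only [layerFun_layerMk]
    exact map_smul _ r x
  map_zero' := by
    have h := (layerIdeal δ n k).zero_mem
    rw [show (0 : layer δ n k) = layerMk δ n k 0 h from Subtype.ext (map_zero _).symm,
      layerFun_layerMk, map_zero]
  map_add' y y' := by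
    obtain ⟨x, hx, rfl⟩ := exists_layerMk_eq y
    obtain ⟨x', hx', rfl⟩ := exists_layerMk_eq y'
    have h := (layerIdeal δ n k).add_mem hx hx'
    rw [show layerMk δ n k x hx + layerMk δ n k x' hx' = layerMk δ n k (x + x') h from
      Subtype.ext (map_add _ x x').symm]
    simp only [layerFun_layerMk]
    exact map_add _ x x'
  map_mul' y y' := by
    obtain ⟨x, hx, rfl⟩ := exists_layerMk_eq y
    obtain ⟨x', hx', rfl⟩ := exists_layerMk_eq y'
    have h := (layerIdeal δ n k).mul_mem_right _ x' hx
    rw [show layerMk δ n k x hx * layerMk δ n k x' hx' = layerMk δ n k (x * x') h from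
      Subtype.ext (map_mul _ x x').symm]
    simp only [layerFun_layerMk]
    exact toInflation_mul (mem_layerIdeal_iff.1 hx) (mem_layerIdeal_iff.1 hx')

theorem layerHom_layerMk {x : typeC (δ : R) n} (hx : x ∈ layerIdeal δ n k) :
    layerHom δ n k (layerMk δ n k x hx) = toInflation δ n k x := layerFun_layerMk hx

theorem layerHom_bijective : Function.Bijective (layerHom δ n k) := by
  constructor
  · intro y y' h
    obtain ⟨x, hx, rfl⟩ := exists_layerMk_eq y
    obtain ⟨x', hx', rfl⟩ := exists_layerMk_eq y'
    rw [layerHom_layerMk, layerHom_layerMk, ← sub_eq_zero, ← map_sub] at h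
    -- An element of J_k with image zero equals its own error term, which lies in J_{k+1}.
    have h1 := ofInflation_toInflation (Submodule.sub_mem _ (mem_layerIdeal_iff.1 hx)
      (mem_layerIdeal_iff.1 hx'))
    rw [h, map_zero, sub_zero] at h1
    exact (layerMk_eq_iff hx hx').2 h1
  · intro t
    exact ⟨layerMk δ n k _ (mem_layerIdeal_iff.2 (ofInflation_mem t)),
      (layerHom_layerMk δ n k _).trans (toInflation_ofInflation t)⟩

end

end TypeCBrauer

theorem mainTheorem2 {R : Type*} [CommRing R] (δ : Rˣ) (n k : ℕ) (hk : k ≤ n) :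
    (∀ (i : ℕ) (x : TypeCBrauer.typeC (δ : R) n),
      x ∈ TypeCBrauer.layerIdeal δ n i ↔
        ∀ d : TypeCBrauer.BrauerDiagram (2 * n),
          TypeCBrauer.BrauerAlgebra.coeff (x : TypeCBrauer.BrauerAlgebra (δ : R) (2 * n)) d ≠ 0 →
            i ≤ d.arcs) ∧
    (∀ v w : TypeCBrauer.DangleModule R n k,
      TypeCBrauer.invMap R (n - k) (TypeCBrauer.form δ n k v w) = TypeCBrauer.form δ n k w v) ∧
    ∃ ψ : TypeCBrauer.layer δ n k →ₙₐ[R] TypeCBrauer.Inflation (TypeCBrauer.form δ n k),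
      Function.Bijective ψ ∧
      ∀ (d : TypeCBrauer.BrauerDiagram (2 * n)) (hd : d.IsSymm) (hdk : d.arcs = k)
        (hJ : TypeCBrauer.symOf (δ : R) d hd ∈ TypeCBrauer.layerIdeal δ n k),
        ψ (TypeCBrauer.layerMk δ n k (TypeCBrauer.symOf (δ : R) d hd) hJ) =
          TypeCBrauer.Inflation.tmul (TypeCBrauer.form δ n k)
            (Finsupp.single (d.topDangle hd hdk) 1)
            (Finsupp.single (d.botDangle hd hdk) 1)
            (MonoidAlgebra.of R (TypeCBrauer.hyperoctahedral (n - k))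
              (d.throughPerm hd hdk)) := by
  refine ⟨fun i x => TypeCBrauer.mem_layerIdeal_iff.trans TypeCBrauer.mem_arcSpan,
    TypeCBrauer.invMap_form δ n k, TypeCBrauer.layerHom δ n k,
    TypeCBrauer.layerHom_bijective δ n k, fun d hd hdk hJ => ?_⟩
  rw [TypeCBrauer.layerHom_layerMk]
  exact TypeCBrauer.toInflation_symOf hd hdk
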